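/- Let $T$ be a complete first-order theory in a language $L$, with monster model $\mathbb{M}$; write $|T|=|L|+\aleph_0$. All tuples are finite. For an infinite cardinal $\lambda$ and a set $A$ of parameters, a sequence $\bar b=\langle b_\alpha:\alpha<\lambda\rangle$ of $n$-tuples (for some $n<\omega$) witnesses that a formula $\varphi(x;a)$ $\lambda$-shreds over $A$ if $\bar b$ is indiscernible over $A$ and for no $\alpha<\lambda$ and no $c\in\varphi(\mathbb{M};a)$ is the tail $\langle b_\beta:\alpha\le\beta<\lambda\rangle$ indiscernible over $A\cup c$. A type $p$ over $B$ shreds over $A$ with a built-in witness if $A\subseteq B$ and $p$ implies a formula that $\lambda$-shreds over $A$ for $\lambda=(|T|+|A|)^+$, as witnessed by a sequence contained in $B$. For $m<\omega$ let $\kappa^m_{\mathrm{shred}}(T)$ be the least regular cardinal $\kappa$ such that there are no increasing continuous sequence of models $\langle M_i:i\le\kappa\rangle$ (that is, elementary submodels of $\mathbb{M}$ with $M_i\subseteq M_j$ for $i\le j\le\kappa$ and $M_\delta=\bigcup_{i<\delta}M_i$ for every limit $\delta\le\kappa$) and type $p\in S^m(M_\kappa)$ such that for every $i<\kappa$ the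 restriction $p\upharpoonright M_{i+1}$ shreds over $M_i$ with a built-in witness; if there is no such cardinal, put $\kappa^m_{\mathrm{shred}}(T)=\infty$. Let $\kappa_{\mathrm{shred}}(T)=\sup_{m<\omega}\kappa^m_{\mathrm{shred}}(T)$, and call $T$ unshreddable if $\kappa_{\mathrm{shred}}(T)<\infty$. Theorem. For every $m\ge 1$, $\kappa^m_{\mathrm{shred}}(T)=\kappa^1_{\mathrm{shred}}(T)$. Consequently $\kappa_{\mathrm{shred}}(T)=\kappa^1_{\mathrm{shred}}(T)$, and $T$ is unshreddable if and only if $\kappa^1_{\mathrm{shred}}(T)<\infty$. -/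

import Mathlib

open FirstOrder Cardinal

universe u v

namespace Shredding

variable {L : FirstOrder.Language.{u, v}}

/-- The sequence `b` of `n`-tuples, indexed by a linear order, is indiscernible over `A`: any two
increasing finite subsequences of the same length satisfy the same formulas with parameters
from `A`. -/
def IndiscernibleOver {N : Type (max u v)} [L.Structure N] (A : Set N)
    {I : Type*} [LinearOrder I] {n : ℕ} (b : I → Fin n → N) : Prop :=
  ∀ (r : ℕ) (ψ : L[[A]].Formula (Fin r × Fin n)) (s t : Fin r → I),
    StrictMono s → StrictMono t →
      (ψ.Realize (fun q => b (s q.1) q.2) ↔ ψ.Realize (fun q => b (t q.1) q.2))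

/-- `b = ⟨b_α : α < lam⟩`, a sequence of finite tuples of `N`, witnesses that `φ(x; a)` `lam`-shreds
over `A`: it is indiscernible over `A`, and for no `α < lam` and no `c` satisfying `φ(x; a)` is
the tail `⟨b_β : α ≤ β < lam⟩` indiscernible over `A ∪ c`.

In place of a fixed monster model, `c` ranges over the realizations of `φ(x; a)` in all elementary
extensions `f : N ↪ₑ[L] N'` of the ambient model. -/
structure IsShredWitness {N : Type (max u v)} [L.Structure N] (lam : Cardinal.{max u v})
    (A : Set N) {m k : ℕ} (φ : L.Formula (Fin m ⊕ Fin k)) (a : Fin k → N)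
    {n : ℕ} (b : Set.Iio lam.ord → Fin n → N) : Prop where
  indiscernible : IndiscernibleOver (L := L) A b
  not_tail_indiscernible :
    ∀ (N' : Type (max u v)) [L.Structure N'] (f : N ↪ₑ[L] N')
      (α : Set.Iio lam.ord) (c : Fin m → N'),
      φ.Realize (Sum.elim c (fun j => f (a j))) →
        ¬ IndiscernibleOver (L := L) (f '' A ∪ Set.range c)
            (fun (β : Set.Ici α) (j : Fin n) => f (b β j))

/-- `S^m(B)`: the complete types over `B` in `m` variables. -/
abbrev TypesOver (L : FirstOrder.Language.{u, v}) {N : Type (max u v)} [L.Structure N]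
    (B : Set N) (m : ℕ) :=
  (L[[B]].completeTheory N).CompleteType (Fin m)

/-- The restriction of a complete type over `B` to a subset `A` of `B`, as a set of formulas
over `A`. -/
def restrict {N : Type (max u v)} [L.Structure N] {A B : Set N} (h : A ⊆ B) {m : ℕ}
    (p : TypesOver L B m) : Set (L[[A]].Formula (Fin m)) :=
  {φ | FirstOrder.Language.Formula.equivSentence
    ((L.lhomWithConstantsMap (Set.inclusion h)).onFormula φ) ∈ p}

/-- The tuple `c` of an elementary extension `N'` of `N` satisfies every formula of the set `π` of
formulas over `B ⊆ N`. -/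
def RealizesType {N : Type (max u v)} [L.Structure N] {B : Set N} {m : ℕ}
    (π : Set (L[[B]].Formula (Fin m))) {N' : Type (max u v)} [L.Structure N'] (f : N ↪ₑ[L] N')
    (c : Fin m → N') : Prop :=
  ∀ ψ ∈ π, FirstOrder.Language.Formula.Realize
    (FirstOrder.Language.BoundedFormula.constantsVarsEquiv ψ : L.Formula (B ⊕ Fin m))
    (Sum.elim (fun d : B => f d) c)

/-- The set `π` of formulas over `B` implies the formula `φ(x; a)`. -/
def Implies {N : Type (max u v)} [L.Structure N] {B : Set N} {m k : ℕ}
    (π : Set (L[[B]].Formula (Fin m))) (φ : L.Formula (Fin m ⊕ Fin k)) (a : Fin k → N) : Prop :=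
  ∀ (N' : Type (max u v)) [L.Structure N'] (f : N ↪ₑ[L] N') (c : Fin m → N'),
    RealizesType π f c → φ.Realize (Sum.elim c (fun j => f (a j)))

/-- The type `π` over `B` `lam`-shreds over `A` with a built-in witness: `A ⊆ B`, and `π` implies a
formula that `lam`-shreds over `A`, as witnessed by a sequence contained in `B`. -/
def ShredsWithBuiltInWitness {N : Type (max u v)} [L.Structure N] (lam : Cardinal.{max u v})
    (A : Set N) {B : Set N} {m : ℕ} (π : Set (L[[B]].Formula (Fin m))) : Prop :=
  A ⊆ B ∧
  ∃ (k : ℕ) (φ : L.Formula (Fin m ⊕ Fin k)) (a : Fin k → N)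
    (n : ℕ) (b : Set.Iio lam.ord → Fin n → N),
    Implies π φ a ∧ IsShredWitness lam A φ a b ∧ ∀ α j, b α j ∈ B

/-- The default length `(|T| + |A|)⁺`, where `|T| = |L| + ℵ₀`. -/
noncomputable def defaultLength (L : FirstOrder.Language.{u, v}) {N : Type (max u v)}
    (A : Set N) : Cardinal.{max u v} :=
  Order.succ (L.card + ℵ₀ + #A)

/-- There are an increasing continuous sequence `⟨M_i : i ≤ κ⟩` of models of `T` (elementary
submodels of an ambient model `N`) and `p ∈ S^m(M_κ)` such that, for all `i < κ`, the restriction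
of `p` to `M_{i+1}` shreds over `M_i` with a built-in witness. The values of `M` at ordinals
above `κ` are irrelevant. -/
def HasShreddingChain (T : L.Theory) (m : ℕ) (κ : Cardinal.{max u v}) : Prop :=
  ∃ (N : FirstOrder.Language.Theory.ModelType.{u, v, max u v} T)
    (M : Ordinal.{max u v} → L.ElementarySubstructure N)
    (p : TypesOver L (M κ.ord : Set N) m),
    (∀ i j, i ≤ j → j ≤ κ.ord → (M i : Set N) ⊆ M j) ∧
    (∀ δ, Order.IsSuccLimit δ → δ ≤ κ.ord → (M δ : Set N) = ⋃ i ∈ Set.Iio δ, (M i : Set N)) ∧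
    ∀ i, i < κ.ord → ∃ h : (M (Order.succ i) : Set N) ⊆ M κ.ord,
      ShredsWithBuiltInWitness (defaultLength L (M i : Set N)) (M i : Set N) (restrict h p)

open Classical in
/-- `κ^m_shred(T)`: the least regular cardinal `κ` for which there is no shredding chain of
length `κ` in `m` variables, and `∞ = ⊤` if there is no such cardinal. -/
noncomputable def kappaShredIn (T : L.Theory) (m : ℕ) : WithTop Cardinal.{max u v} :=
  if ∃ κ : Cardinal.{max u v}, κ.IsRegular ∧ ¬ HasShreddingChain T m κ then
    ((sInf {κ : Cardinal.{max u v} | κ.IsRegular ∧ ¬ HasShreddingChain T m κ} :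
      Cardinal.{max u v}) : WithTop Cardinal.{max u v})
  else ⊤

/-- `κ_shred(T) = sup_m κ^m_shred(T)`. -/
noncomputable def kappaShred (T : L.Theory) : WithTop Cardinal.{max u v} :=
  ⨆ m : ℕ, kappaShredIn T m

/-- `T` is unshreddable if `κ_shred(T) < ∞`. -/
def Unshreddable (T : L.Theory) : Prop := kappaShred T < ⊤

end Shredding

universe w x y u' v'

namespace Shredding

variable {L : FirstOrder.Language.{u, v}}

/-! Shredding chains are traded for a combinatorial object, a system (`HasSystem`): for each i < κ a
formula φ_i(x; a_i), a sequence cut into finite blocks that is indiscernible over everything chosen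
at earlier indices, and an alternating formula Ψ_i, one that never holds of a tuple and a block
indiscernible over it. Here φ_i(x; a_i) implies Ψ_i(x; block) for every block, and a single c
satisfies all φ_i. Unlike a chain, a system has no closure conditions and depends only on the type
of its elements, so compactness and Ramsey's theorem apply to it.

A chain yields a system (`hasSystem_of_hasShreddingChain`). For each α, compactness turns the
failure of indiscernibility of the tail from α into finitely many formulas, parameters and positions
above α. Apart from the positions there are fewer such data than the regular length of the sequence,
so one datum serves all α and produces ω successive blocks with the same alternating formula
(`exists_alternating_blocks`). Conversely (`hasShreddingChain_of_hasSystem`), the sequences of a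
system are stretched to rapidly growing lengths and made indiscernible in a Skolem language; the
Skolem hulls of the initial parts are then the models of a chain.

The number of variables drops by a dichotomy on a stretched system in m + 1 variables
(`hasSystem_succ`). Going through i < κ, one adds greedily to all the φ_i(x; a_i) the statement that
some tail of the i-th sequence is indiscernible over the earlier elements and the first m variables.
If this is impossible for cofinally many i, the extraction of blocks at those i gives a system in
the first m variables. If it is possible from some i on, the first m coordinates of a realization
become parameters, and the last coordinate carries a system in one variable. For regular κ,
induction on m leads to m = 1, since no system exists for m = 0; dummy variables give the converse
for m ≥ 1. -/

/-! ### Ramsey's theorem -/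

/-- Iterated ultrafilter quantifiers: `ultraColor U χ k s` says that `χ` holds of `s` enlarged by
`k` generic elements. -/
def ultraColor (U : Ultrafilter ℕ) (χ : Finset ℕ → Prop) : ℕ → Finset ℕ → Prop
  | 0, s => χ s
  | k + 1, s => ∀ᶠ n in (U : Filter ℕ), ultraColor U χ k (insert n s)

theorem ultraColor_not (U : Ultrafilter ℕ) (χ : Finset ℕ → Prop) (k : ℕ) (s : Finset ℕ) :
    ultraColor U (fun s => ¬ χ s) k s ↔ ¬ ultraColor U χ k s := by
  induction k generalizing s with
  | zero => rfl
  | succ k ih =>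
    simp only [ultraColor, ih]
    exact Ultrafilter.eventually_not

/-- The set is built one element at a time, keeping every subset with at most `r` elements
generically extendable to an `r`-set with `χ`. Almost every n, in the sense of the ultrafilter,
preserves this, and so does some n above all earlier elements. -/
theorem exists_homogeneous_of_ultraColor (r : ℕ) (χ : Finset ℕ → Prop)
    (h0 : ultraColor (Filter.hyperfilter ℕ) χ r ∅) :
    ∃ h : ℕ → ℕ, StrictMono h ∧ ∀ s : Finset ℕ, s.card = r → χ (s.image h) := by
  let U := Filter.hyperfilter ℕ
  let Good (S : Finset ℕ) : Prop := ∀ s ⊆ S, ∀ k, s.card + k = r → ultraColor U χ k s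
  have hext : ∀ S, Good S → ∃ n, (∀ x ∈ S, x < n) ∧ Good (insert n S) := by
    intro S hS
    have h1 : ∀ᶠ n in (U : Filter ℕ), ∀ s ∈ S.powerset, ∀ k ∈ Finset.range r, s.card + k + 1 = r →
        ultraColor U χ k (insert n s) := by
      rw [Filter.eventually_all_finset]
      intro s hs
      rw [Filter.eventually_all_finset]
      intro k _
      by_cases hk : s.card + k + 1 = r
      · have := hS s (Finset.mem_powerset.1 hs) (k + 1) (by omega)
        filter_upwards [this] with n hn _ using hn
      · exact Filter.Eventually.of_forall fun n h => absurd h hk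
    have h2 : ∀ᶠ n in (U : Filter ℕ), ∀ x ∈ S, x < n := by
      rw [Filter.eventually_all_finset]
      intro x _
      have : (Set.Iic x)ᶜ ∈ Filter.hyperfilter ℕ :=
        Set.Finite.compl_mem_hyperfilter (Set.finite_Iic x)
      filter_upwards [this] with n hn
      simpa using hn
    obtain ⟨n, hn1, hn2⟩ := (h1.and h2).exists
    refine ⟨n, hn2, fun s hs k hk => ?_⟩
    by_cases hns : n ∈ s
    · have hcard := Finset.card_erase_add_one hns
      have := hn1 (s.erase n) (Finset.mem_powerset.2 fun x hx => ?_) k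
        (Finset.mem_range.2 (by omega)) (by omega)
      · rwa [Finset.insert_erase hns] at this
      · have h3 := Finset.mem_erase.1 hx
        exact (Finset.mem_insert.1 (hs h3.2)).resolve_left h3.1
    · exact hS s (fun x hx => (Finset.mem_insert.1 (hs hx)).resolve_left
        (fun h => hns (h ▸ hx))) k hk
  have hempty : Good ∅ := by
    intro s hs k hk
    obtain rfl := Finset.subset_empty.1 hs
    simp only [Finset.card_empty, zero_add] at hk
    exact hk ▸ h0
  choose next hlt hgood using hext
  let S : ℕ → {S : Finset ℕ // Good S} := fun n =>
    Nat.rec ⟨∅, hempty⟩ (fun _ T => ⟨insert (next T.1 T.2) T.1, hgood T.1 T.2⟩) n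
  let h : ℕ → ℕ := fun n => next (S n).1 (S n).2
  have hS : ∀ n, (S (n + 1)).1 = insert (h n) (S n).1 := fun n => rfl
  have hmem : ∀ n m, m < n → h m ∈ (S n).1 := by
    intro n
    induction n with
    | zero => intro m hm; omega
    | succ n ih =>
      intro m hm
      rw [hS, Finset.mem_insert]
      rcases Nat.lt_succ_iff_lt_or_eq.1 hm with h' | rfl
      · exact Or.inr (ih m h')
      · exact Or.inl rfl
  have hmono : StrictMono h := fun m n hmn => hlt _ _ _ (hmem n m hmn)
  refine ⟨h, hmono, fun s hs => ?_⟩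
  refine (S (s.sup id + 1)).2 (s.image h) (fun x hx => ?_) 0 ?_
  · obtain ⟨m, hm, rfl⟩ := Finset.mem_image.1 hx
    exact hmem _ _ (Nat.lt_succ_of_le (Finset.le_sup (f := id) hm))
  · rw [Finset.card_image_of_injective _ hmono.injective, hs, add_zero]

/-- Increasing tuples are coded by their ranges. An ultrafilter decides every property, so either
`χ'` or its negation holds generically; in the second case the premise of the implication always
fails. -/
theorem exists_homogeneous (r : ℕ) (χ : (Fin r → ℕ) → Prop) :
    ∃ h : ℕ → ℕ, StrictMono h ∧ ∀ s t : Fin r → ℕ, StrictMono s → StrictMono t →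
      χ (h ∘ s) → χ (h ∘ t) := by
  let χ' : Finset ℕ → Prop := fun s => ∃ hs : s.card = r, χ (s.orderEmbOfFin hs)
  have key : ∀ (h : ℕ → ℕ) (_ : StrictMono h) (s : Fin r → ℕ) (_ : StrictMono s),
      χ (h ∘ s) ↔ χ' ((Finset.univ.image s).image h) := by
    intro h hh s hs
    have hc : ((Finset.univ.image s).image h).card = r := by
      rw [Finset.card_image_of_injective _ hh.injective,
        Finset.card_image_of_injective _ hs.injective, Finset.card_univ, Fintype.card_fin]
    have he : h ∘ s = ((Finset.univ.image s).image h).orderEmbOfFin hc :=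
      Finset.orderEmbOfFin_unique hc
        (fun x => Finset.mem_image_of_mem _ (Finset.mem_image_of_mem _ (Finset.mem_univ x)))
        (hh.comp hs)
    constructor
    · intro h1; exact ⟨hc, he ▸ h1⟩
    · rintro ⟨_, h1⟩; rw [he]; exact h1
  have hcard : ∀ s : Fin r → ℕ, StrictMono s → (Finset.univ.image s).card = r := by
    intro s hs
    rw [Finset.card_image_of_injective _ hs.injective, Finset.card_univ, Fintype.card_fin]
  by_cases h0 : ultraColor (Filter.hyperfilter ℕ) χ' r ∅
  · obtain ⟨h, hh, hs⟩ := exists_homogeneous_of_ultraColor r χ' h0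
    exact ⟨h, hh, fun s t _ ht _ => (key h hh t ht).2 (hs _ (hcard t ht))⟩
  · rw [← ultraColor_not] at h0
    obtain ⟨h, hh, hs⟩ := exists_homogeneous_of_ultraColor r _ h0
    exact ⟨h, hh, fun s t hs' _ h1 => absurd ((key h hh s hs').1 h1) (hs _ (hcard s hs'))⟩

/-- Ramsey's theorem for finitely many colourings at once. -/
theorem exists_homogeneous_finset {ι : Type*} (F : Finset ι) (r : ι → ℕ)
    (χ : ∀ i, (Fin (r i) → ℕ) → Prop) :
    ∃ h : ℕ → ℕ, StrictMono h ∧ ∀ i ∈ F, ∀ s t : Fin (r i) → ℕ, StrictMono s → StrictMono t →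
      χ i (h ∘ s) → χ i (h ∘ t) := by
  classical
  induction F using Finset.induction_on with
  | empty => exact ⟨id, strictMono_id, by simp⟩
  | insert i F _ ih =>
    obtain ⟨h, hh, hF⟩ := ih
    obtain ⟨h', hh', hi⟩ := exists_homogeneous (r i) (fun s => χ i (h ∘ s))
    refine ⟨h ∘ h', hh.comp hh', fun j hj s t hs ht => ?_⟩
    rcases Finset.mem_insert.1 hj with rfl | hj
    · exact hi s t hs ht
    · exact hF j hj (h' ∘ s) (h' ∘ t) (hh'.comp hs) (hh'.comp ht)

/-! ### Formulas and compactness -/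

/-- A formula uses only finitely many of its parameters. -/
theorem exists_finite_parameters {P : Type w} {Q : Type x} (θ : L.Formula (P ⊕ Q)) :
    ∃ (k : ℕ) (e : Fin k → P) (θ' : L.Formula (Fin k ⊕ Q)), Function.Injective e ∧
      ∀ (N : Type y) [L.Structure N] (g : P → N) (h : Q → N),
        θ'.Realize (Sum.elim (g ∘ e) h) ↔ θ.Realize (Sum.elim g h) := by
  classical
  let S : Finset P := θ.freeVarFinset.toLeft
  let f : θ.freeVarFinset → Fin S.card ⊕ Q := fun a =>
    match a with
    | ⟨Sum.inl p, hp⟩ => Sum.inl (S.equivFin ⟨p, Finset.mem_toLeft.2 hp⟩)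
    | ⟨Sum.inr q, _⟩ => Sum.inr q
  refine ⟨S.card, fun i => (S.equivFin.symm i).1, θ.restrictFreeVar f,
    Subtype.val_injective.comp S.equivFin.symm.injective, ?_⟩
  intro N _ g h
  refine FirstOrder.Language.BoundedFormula.realize_restrictFreeVar _ ?_
  rintro ⟨p | q, hp⟩
  · simp [f]
  · simp [f]

/-- Existential quantification over an arbitrary family of variables. -/
theorem exists_projection {P : Type w} {Q : Type x} (θ : L.Formula (P ⊕ Q)) :
    ∃ θ' : L.Formula P, ∀ (N : Type y) [L.Structure N] [Nonempty N] (g : P → N),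
        θ'.Realize g ↔ ∃ h : Q → N, θ.Realize (Sum.elim g h) := by
  obtain ⟨k, e, θ', he, H⟩ := exists_finite_parameters.{u, v, x, w, y}
    (P := Q) (Q := P) (FirstOrder.Language.Formula.relabel Sum.swap θ)
  have H' : ∀ (N : Type y) [L.Structure N] (g : P → N) (h : Q → N),
      θ'.Realize (Sum.elim (h ∘ e) g) ↔ θ.Realize (Sum.elim g h) := by
    intro N _ g h
    rw [H, FirstOrder.Language.Formula.realize_relabel]
    congr! 1
    funext a
    rcases a with a | a <;> rfl
  refine ⟨(FirstOrder.Language.Formula.relabel Sum.swap θ' : L.Formula (P ⊕ Fin k)).iExs (Fin k),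
    ?_⟩
  intro N _ hN g
  have hsw : ∀ z : Fin k → N, Sum.elim g z ∘ Sum.swap = Sum.elim z g := by
    intro z; funext a; rcases a with a | a <;> rfl
  simp only [FirstOrder.Language.Formula.realize_iExs,
    FirstOrder.Language.Formula.realize_relabel, hsw]
  constructor
  · rintro ⟨z, hz⟩
    refine ⟨Function.extend e z (fun _ => hN.some), (H' N g _).1 ?_⟩
    have : Function.extend e z (fun _ => hN.some) ∘ e = z := by
      funext a; exact he.extend_apply _ _ a
    rwa [this]
  · rintro ⟨h, hh⟩
    exact ⟨h ∘ e, (H' N g h).2 hh⟩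

/-- Finite satisfiability, in the variables `V`, of formulas with parameters `g : P → N`. -/
def FinSat {N : Type*} [L.Structure N] {P V : Type*} (g : P → N)
    (S : Set (L.Formula (P ⊕ V))) : Prop :=
  ∀ F : Finset (L.Formula (P ⊕ V)), ↑F ⊆ S → ∃ z : V → N, ∀ ψ ∈ F, ψ.Realize (Sum.elim g z)

/-- Compactness: finitely satisfiable sets of formulas are realized in elementary extensions. -/
theorem exists_realization {N : Type (max u v)} [L.Structure N] [Nonempty N] {P : Type w}
    {V : Type x} (g : P → N) (S : Set (L.Formula (P ⊕ V))) (hS : FinSat g S) :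
    ∃ (N' : Type (max u v x)) (_ : L.Structure N') (f : N ↪ₑ[L] N') (z : V → N'),
      ∀ ψ ∈ S, ψ.Realize (Sum.elim (f ∘ g) z) := by
  classical
  let G : Set (L.Formula (N ⊕ V)) :=
    (fun ψ => FirstOrder.Language.Formula.relabel (Sum.map g id) ψ) '' S ∪
    (fun χ => FirstOrder.Language.Formula.relabel Sum.inl χ) '' {χ : L.Formula N | χ.Realize id}
  let T : L[[N ⊕ V]].Theory := FirstOrder.Language.Formula.equivSentence '' G
  have hT : T.IsFinitelySatisfiable := by
    intro T0 hT0
    -- A finite part of the theory consists of formulas coming from `S` and of formulas true in `N`.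
    -- `F` picks preimages for the former; a tuple of `N` realizing `F` interprets the new
    -- constants.
    obtain ⟨G0, hG0, hG0'⟩ := Finset.subset_set_image_iff.1 hT0
    let F : Finset (L.Formula (P ⊕ V)) := (G0.filter (fun ψ => ∃ χ ∈ S,
      FirstOrder.Language.Formula.relabel (Sum.map g id) χ = ψ)).attach.image
      (fun ψ => (Finset.mem_filter.1 ψ.2).2.choose)
    obtain ⟨z, hz⟩ := hS F (by
      intro ψ hψ
      obtain ⟨χ, -, rfl⟩ := Finset.mem_image.1 (Finset.mem_coe.1 hψ)
      exact (Finset.mem_filter.1 χ.2).2.choose_spec.1)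
    have hreal : ∀ ψ ∈ G0, ψ.Realize (Sum.elim id z) := by
      intro ψ hψ
      rcases hG0 hψ with ⟨χ, hχ, h⟩ | ⟨χ, hχ, rfl⟩
      · have hm : ψ ∈ G0.filter (fun ψ => ∃ χ ∈ S,
            FirstOrder.Language.Formula.relabel (Sum.map g id) χ = ψ) :=
          Finset.mem_filter.2 ⟨hψ, χ, hχ, h⟩
        have h1 := hz _ (Finset.mem_image.2 ⟨⟨ψ, hm⟩, Finset.mem_attach _ _, rfl⟩)
        have h2 := (Finset.mem_filter.1 hm).2.choose_spec.2
        rw [← h2, FirstOrder.Language.Formula.realize_relabel, Sum.elim_comp_map]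
        exact h1
      · rw [FirstOrder.Language.Formula.realize_relabel]
        exact hχ
    let _ := FirstOrder.Language.constantsOn.structure (Sum.elim (id : N → N) z)
    have : N ⊨ (↑T0 : L[[N ⊕ V]].Theory) := by
      refine ⟨fun φ hφ => ?_⟩
      rw [← hG0'] at hφ
      obtain ⟨ψ, hψ, rfl⟩ := Finset.mem_image.1 (Finset.mem_coe.1 hφ)
      rw [FirstOrder.Language.Formula.realize_equivSentence]
      exact hreal ψ hψ
    exact FirstOrder.Language.Theory.Model.isSatisfiable N
  obtain ⟨M⟩ := FirstOrder.Language.Theory.isSatisfiable_iff_isFinitelySatisfiable.2 hT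
  let _ : L.Structure M := (L.lhomWithConstants (N ⊕ V)).reduct M
  have : (L.lhomWithConstants (N ⊕ V)).IsExpansionOn M :=
    (L.lhomWithConstants (N ⊕ V)).isExpansionOn_reduct M
  let cst : N ⊕ V → M := fun a => (L.con a : M)
  have hM : ∀ ψ ∈ G, ψ.Realize cst := by
    intro ψ hψ
    rw [← FirstOrder.Language.Formula.realize_equivSentence]
    exact FirstOrder.Language.Theory.realize_sentence_of_mem T (Set.mem_image_of_mem _ hψ)
  have hdiag : ∀ χ : L.Formula N, χ.Realize id → χ.Realize (cst ∘ Sum.inl) := by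
    intro χ hχ
    have := hM _ (Or.inr (Set.mem_image_of_mem _ hχ))
    rwa [FirstOrder.Language.Formula.realize_relabel] at this
  refine ⟨M, inferInstance, ⟨cst ∘ Sum.inl, ?_⟩, cst ∘ Sum.inr, ?_⟩
  · intro n φ x
    have h1 := hdiag (FirstOrder.Language.Formula.relabel x φ)
    have h2 := hdiag (∼ (FirstOrder.Language.Formula.relabel x φ))
    simp only [FirstOrder.Language.Formula.realize_not,
      FirstOrder.Language.Formula.realize_relabel, Function.id_comp] at h1 h2
    exact ⟨fun h => by_contra fun h' => h2 h' h, h1⟩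
  · intro ψ hψ
    have := hM _ (Or.inl (Set.mem_image_of_mem _ hψ))
    rw [FirstOrder.Language.Formula.realize_relabel] at this
    convert this using 1
    funext a
    rcases a with a | a <;> rfl

/-! ### Indiscernible sequences -/

/-- The sequence `b` is indiscernible over the family `g` of parameters. -/
def Indisc (L : FirstOrder.Language.{u, v}) {N : Type y} [L.Structure N] {P : Type w} (g : P → N)
    {I : Type x} [LinearOrder I] {n : ℕ} (b : I → Fin n → N) : Prop :=
  ∀ (r : ℕ) (ψ : L.Formula (P ⊕ Fin r × Fin n)) (s t : Fin r → I), StrictMono s → StrictMono t →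
    ψ.Realize (Sum.elim g fun q => b (s q.1) q.2) → ψ.Realize (Sum.elim g fun q => b (t q.1) q.2)

section Indisc

variable {N : Type y} [L.Structure N] {P : Type w} {P' : Type*} {g : P → N}
  {I : Type x} {I' : Type*} [LinearOrder I] [LinearOrder I'] {n : ℕ} {b : I → Fin n → N}

theorem Indisc.of_range (h : Indisc L g b) {g' : P' → N} (hg : ∀ p', ∃ p, g p = g' p') :
    Indisc L g' b := by
  choose f hf using hg
  intro r ψ s t hs ht hψ
  have key : ∀ z : Fin r × Fin n → N, (ψ.relabel (Sum.map f id)).Realize (Sum.elim g z) ↔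
      ψ.Realize (Sum.elim g' z) := by
    intro z
    rw [FirstOrder.Language.Formula.realize_relabel, Sum.elim_comp_map,
      show g ∘ f = g' from funext hf, Function.comp_id]
  exact (key _).1 (h r (ψ.relabel (Sum.map f id)) s t hs ht ((key _).2 hψ))

theorem Indisc.comp_strictMono (h : Indisc L g b) {f : I' → I} (hf : StrictMono f) :
    Indisc L g (fun i => b (f i)) :=
  fun r ψ s t hs ht => h r ψ (f ∘ s) (f ∘ t) (hf.comp hs) (hf.comp ht)

/-- Each instance of indiscernibility is a single formula in the named elements, so indiscernibility
is read off from their type. -/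
theorem Indisc.of_realize {N' : Type*} [L.Structure N'] {α : Type*} {z : α → N} {z' : α → N'}
    (hz : ∀ ψ : L.Formula α, ψ.Realize z → ψ.Realize z') {p : P → α} {β : I → Fin n → α}
    (h : Indisc L (z ∘ p) (fun i l => z (β i l))) :
    Indisc L (z' ∘ p) (fun i l => z' (β i l)) := by
  intro r ψ s t hs ht
  have key := hz ((ψ.relabel (Sum.elim p fun q => β (s q.1) q.2)).imp
    (ψ.relabel (Sum.elim p fun q => β (t q.1) q.2)))
  simp only [FirstOrder.Language.Formula.realize_imp,
    FirstOrder.Language.Formula.realize_relabel, Sum.comp_elim] at key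
  exact key (h r ψ s t hs ht)

theorem Indisc.map {N' : Type*} [L.Structure N'] (h : Indisc L g b) (f : N ↪ₑ[L] N') :
    Indisc L (f ∘ g) (fun i l => f (b i l)) :=
  Indisc.of_realize (z := (id : N → N)) (z' := f)
    (fun ψ hψ => (f.map_formula ψ id).2 hψ) (p := g) (β := b) h

theorem Indisc.append (h : Indisc L g b) {k : ℕ} {e : Fin k → N} (he : ∀ i, ∃ p, g p = e i) :
    Indisc L g (fun i => Fin.append (b i) e) := by
  choose f hf using he
  intro r ψ s t hs ht hψ
  let ρ : P ⊕ Fin r × Fin (n + k) → P ⊕ Fin r × Fin n := fun a => match a with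
    | Sum.inl p => Sum.inl p
    | Sum.inr (q, l) => Fin.addCases (fun l => Sum.inr (q, l)) (fun l => Sum.inl (f l)) l
  have key : ∀ s : Fin r → I, (ψ.relabel ρ).Realize (Sum.elim g fun q => b (s q.1) q.2) ↔
      ψ.Realize (Sum.elim g fun q => Fin.append (b (s q.1)) e q.2) := by
    intro s
    rw [FirstOrder.Language.Formula.realize_relabel]
    congr! 1
    funext a
    rcases a with p | ⟨q, l⟩
    · rfl
    · refine Fin.addCases (fun l => ?_) (fun l => ?_) l
      · simp [ρ]
      · simp [ρ, hf]
  exact (key t).1 (h r (ψ.relabel ρ) s t hs ht ((key s).2 hψ))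

/-- Since `e` is repeated in every term, a formula with parameters `e` can read them from the first
term it mentions. -/
theorem Indisc.of_append {k : ℕ} {e : Fin k → N}
    (h : Indisc L g (fun i => Fin.append (b i) e)) : Indisc L (Sum.elim g e) b := by
  intro r ψ s t hs ht hψ
  -- With no term there is nothing to read `e` from, but then both instances of the formula
  -- coincide.
  rcases r with _ | r
  · convert hψ using 2
    funext q; exact q.1.elim0
  let ρ : (P ⊕ Fin k) ⊕ Fin (r + 1) × Fin n → P ⊕ Fin (r + 1) × Fin (n + k) := fun a => match a with
    | Sum.inl (Sum.inl p) => Sum.inl p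
    | Sum.inl (Sum.inr l) => Sum.inr (0, Fin.natAdd n l)
    | Sum.inr (q, l) => Sum.inr (q, Fin.castAdd k l)
  have key : ∀ s : Fin (r + 1) → I,
      (ψ.relabel ρ).Realize (Sum.elim g fun q => Fin.append (b (s q.1)) e q.2) ↔
      ψ.Realize (Sum.elim (Sum.elim g e) fun q => b (s q.1) q.2) := by
    intro s
    rw [FirstOrder.Language.Formula.realize_relabel]
    congr! 1
    funext a
    rcases a with (p | l) | ⟨q, l⟩ <;> simp [ρ]
  exact (key t).1 (h (r + 1) (ψ.relabel ρ) s t hs ht ((key s).2 hψ))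

end Indisc

/-- Parameters become free variables instead of constants, so that no change of language is needed
when they vary. One implication suffices because `s` and `t` can be exchanged. -/
theorem indiscernibleOver_iff {N : Type (max u v)} [L.Structure N] {A : Set N} {I : Type x}
    [LinearOrder I] {n : ℕ} {b : I → Fin n → N} :
    IndiscernibleOver (L := L) A b ↔ Indisc L (Subtype.val : A → N) b := by
  have key : ∀ (r : ℕ) (ψ : L[[A]].Formula (Fin r × Fin n)) (z : Fin r × Fin n → N),
      FirstOrder.Language.Formula.Realize
        (FirstOrder.Language.BoundedFormula.constantsVarsEquiv ψ : L.Formula (A ⊕ Fin r × Fin n))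
        (Sum.elim Subtype.val z) ↔ ψ.Realize z := fun r ψ z =>
    FirstOrder.Language.BoundedFormula.realize_constantsVarsEquiv
  constructor
  · intro h r ψ s t hs ht hψ
    have h1 := (h r (FirstOrder.Language.BoundedFormula.constantsVarsEquiv.symm ψ) s t hs ht)
    rw [← key, ← key, Equiv.apply_symm_apply] at h1
    exact h1.1 hψ
  · intro h r ψ s t hs ht
    rw [← key, ← key]
    exact ⟨h r _ s t hs ht, h r _ t s ht hs⟩

/-! ### Alternating formulas -/

/-- A formula `Ψ(x; y_0, …, y_{R-1})` is alternating if it never holds of a tuple and a sequence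
indiscernible over that tuple. -/
def IsAlternating {m R n : ℕ} (Ψ : L.Formula (Fin m ⊕ Fin R × Fin n)) : Prop :=
  ∀ (N : Type (max u v)) [L.Structure N] (c : Fin m → N) (b : Fin R → Fin n → N),
    Indisc L c b → ¬ Ψ.Realize (Sum.elim c fun q => b q.1 q.2)

/-- Parameters of an alternating formula can be absorbed into the sequence. -/
theorem exists_alternating_absorb {m k R n : ℕ}
    (Θ : L.Formula (Fin m ⊕ (Fin k ⊕ Fin (R + 1) × Fin n)))
    (hΘ : ∀ (N : Type (max u v)) [L.Structure N] (c : Fin m → N) (e : Fin k → N)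
      (b : Fin (R + 1) → Fin n → N), Indisc L (Sum.elim c e) b →
      ¬ Θ.Realize (Sum.elim c (Sum.elim e fun q => b q.1 q.2))) :
    ∃ Ψ : L.Formula (Fin m ⊕ Fin (R + 1) × Fin (n + k)), IsAlternating Ψ ∧
      ∀ (N : Type (max u v)) [L.Structure N] (c : Fin m → N) (e : Fin k → N)
        (b : Fin (R + 1) → Fin n → N),
        Ψ.Realize (Sum.elim c fun q => Fin.append (b q.1) e q.2) ↔
          Θ.Realize (Sum.elim c (Sum.elim e fun q => b q.1 q.2)) := by
  let ρ : Fin m ⊕ (Fin k ⊕ Fin (R + 1) × Fin n) → Fin m ⊕ Fin (R + 1) × Fin (n + k) :=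
    fun a => match a with
    | Sum.inl p => Sum.inl p
    | Sum.inr (Sum.inl l) => Sum.inr (0, Fin.natAdd n l)
    | Sum.inr (Sum.inr (q, l)) => Sum.inr (q, Fin.castAdd k l)
  -- `Eq` says that the last `k` coordinates do not depend on the term. Without it `Ψ` could hold of
  -- an indiscernible sequence whose last coordinates vary, over which nothing is known about `Θ`.
  let Eq : L.Formula (Fin m ⊕ Fin (R + 1) × Fin (n + k)) :=
    FirstOrder.Language.Formula.iInf (fun ql : Fin (R + 1) × Fin k =>
      (FirstOrder.Language.Term.var (Sum.inr (ql.1, Fin.natAdd n ql.2))).equal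
      (FirstOrder.Language.Term.var (Sum.inr (0, Fin.natAdd n ql.2))))
  have key : ∀ (N : Type (max u v)) [L.Structure N] (c : Fin m → N) (e : Fin k → N)
      (b : Fin (R + 1) → Fin n → N),
      (Θ.relabel ρ ⊓ Eq).Realize (Sum.elim c fun q => Fin.append (b q.1) e q.2) ↔
          Θ.Realize (Sum.elim c (Sum.elim e fun q => b q.1 q.2)) := by
    intro N _ c e b
    rw [FirstOrder.Language.Formula.realize_inf, FirstOrder.Language.Formula.realize_relabel,
      FirstOrder.Language.Formula.realize_iInf]
    have h1 : (Sum.elim c fun q => Fin.append (b q.1) e q.2) ∘ ρ =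
        Sum.elim c (Sum.elim e fun q => b q.1 q.2) := by
      funext a
      rcases a with p | l | ⟨q, l⟩ <;> simp [ρ]
    rw [h1]
    simp [FirstOrder.Language.Formula.realize_equal]
  refine ⟨Θ.relabel ρ ⊓ Eq, ?_, key⟩
  intro N _ c b hb hr
  have hE := (FirstOrder.Language.Formula.realize_inf.1 hr).2
  rw [FirstOrder.Language.Formula.realize_iInf] at hE
  let b' : Fin (R + 1) → Fin n → N := fun q l => b q (Fin.castAdd k l)
  let e : Fin k → N := fun l => b 0 (Fin.natAdd n l)
  have hbe : b = fun q => Fin.append (b' q) e := by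
    funext q l
    refine Fin.addCases (fun l => ?_) (fun l => ?_) l
    · simp [b']
    · have := hE (q, l)
      rw [FirstOrder.Language.Formula.realize_equal] at this
      simpa [e] using this
  rw [hbe] at hb hr
  exact hΘ N c e b' hb.of_append ((key N c e b').1 hr)

/-! ### Shredding systems -/

/-- A formula `φ(x; a)` together with an alternating formula `Ψ(x; y_0, …, y_R)` it is meant to
imply. -/
structure Pattern (L : FirstOrder.Language.{u, v}) (m : ℕ) where
  /-- The number of parameters. -/
  k : ℕ
  /-- One less than the length of the blocks. -/
  R : ℕ
  /-- The length of the tuples in the sequence. -/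
  n : ℕ
  /-- The formula that shreds. -/
  φ : L.Formula (Fin m ⊕ Fin k)
  /-- The alternating formula. -/
  Ψ : L.Formula (Fin m ⊕ Fin (R + 1) × Fin n)
  alternating : IsAlternating Ψ

/-- Names for the elements of a shredding system: the parameters of the formulas and the entries
of the indiscernible sequences, which consist of blocks indexed by `J i`. -/
abbrev Gen {m : ℕ} {I : Type w} (P : I → Pattern L m) (J : I → Type x) : Type (max w x) :=
  Σ i, Fin (P i).k ⊕ (J i ×ₗ Fin ((P i).R + 1)) × Fin (P i).n

/-- `z` interprets the names in `Gen P J` so that the `i`-th sequence is indiscernible over all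
earlier elements, and `φ_i(x; a_i)`, which is satisfied by `c`, implies `Ψ_i(x; -)` for
all blocks of the `i`-th sequence. -/
structure IsSystem {m : ℕ} {I : Type w} [LinearOrder I] (P : I → Pattern L m) (J : I → Type x)
    [∀ i, LinearOrder (J i)] {N : Type y} [L.Structure N] (z : Gen P J → N) (c : Fin m → N) :
    Prop where
  indisc : ∀ i, Indisc L (fun g : {g : Gen P J // g.1 < i} => z g.1)
    (fun p l => z ⟨i, Sum.inr (p, l)⟩)
  imp : ∀ i (ξ : J i) (d : Fin m → N),
    (P i).φ.Realize (Sum.elim d fun l => z ⟨i, Sum.inl l⟩) →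
      (P i).Ψ.Realize (Sum.elim d fun q => z ⟨i, Sum.inr (toLex (ξ, q.1), q.2)⟩)
  sat : ∀ i, (P i).φ.Realize (Sum.elim c fun l => z ⟨i, Sum.inl l⟩)

/-- The formula saying that `φ_i(x; a_i)` implies `Ψ_i` for the block `ξ`. -/
noncomputable def impFormula {m : ℕ} {I : Type w} (P : I → Pattern L m) {J : I → Type x}
    (i : I) (ξ : J i) : L.Formula (Gen P J ⊕ Fin m) :=
  (((P i).φ.relabel (Sum.elim Sum.inr fun l => Sum.inl (Sum.inl ⟨i, Sum.inl l⟩))).imp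
    ((P i).Ψ.relabel (Sum.elim Sum.inr fun q =>
      Sum.inl (Sum.inl ⟨i, Sum.inr (toLex (ξ, q.1), q.2)⟩)))).iAlls (Fin m)

theorem realize_impFormula {m : ℕ} {I : Type w} (P : I → Pattern L m) {J : I → Type x}
    (i : I) (ξ : J i) {N : Type y} [L.Structure N] (z : Gen P J → N) (c : Fin m → N) :
    (impFormula P i ξ).Realize (Sum.elim z c) ↔ ∀ d : Fin m → N,
      (P i).φ.Realize (Sum.elim d fun l => z ⟨i, Sum.inl l⟩) →
      (P i).Ψ.Realize (Sum.elim d fun q => z ⟨i, Sum.inr (toLex (ξ, q.1), q.2)⟩) := by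
  rw [impFormula, FirstOrder.Language.Formula.realize_iAlls]
  refine forall_congr' fun d => ?_
  simp only [FirstOrder.Language.Formula.realize_imp,
    FirstOrder.Language.Formula.realize_relabel, Sum.comp_elim]
  exact Iff.rfl

section System

variable {m : ℕ} {I : Type w} [LinearOrder I] {P : I → Pattern L m} {J : I → Type x}
    [∀ i, LinearOrder (J i)] {N : Type y} [L.Structure N] {z : Gen P J → N} {c : Fin m → N}

/-- Every clause of the definition is a family of formulas in the names and `c`, so systems can be
moved to any realization of the same type. -/
theorem IsSystem.of_realize (h : IsSystem P J z c) {N' : Type*} [L.Structure N'] {z' : Gen P J → N'}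
    {c' : Fin m → N'} (H : ∀ ψ : L.Formula (Gen P J ⊕ Fin m),
      ψ.Realize (Sum.elim z c) → ψ.Realize (Sum.elim z' c')) : IsSystem P J z' c' where
  indisc i := Indisc.of_realize H (p := fun g : {g : Gen P J // g.1 < i} => Sum.inl g.1)
    (β := fun p l => Sum.inl ⟨i, Sum.inr (p, l)⟩) (h.indisc i)
  imp i ξ := (realize_impFormula P i ξ z' c').1
    (H _ ((realize_impFormula P i ξ z c).2 (h.imp i ξ)))
  sat i := by
    have := H ((P i).φ.relabel (Sum.elim Sum.inr fun l => Sum.inl ⟨i, Sum.inl l⟩))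
    simp only [FirstOrder.Language.Formula.realize_relabel, Sum.comp_elim] at this
    exact this (h.sat i)

theorem IsSystem.map (h : IsSystem P J z c) {N' : Type*} [L.Structure N'] (f : N ↪ₑ[L] N') :
    IsSystem P J (f ∘ z) (f ∘ c) := by
  refine h.of_realize fun ψ hψ => ?_
  rw [← Sum.comp_elim]
  exact (f.map_formula ψ _).2 hψ

/-- Renaming of blocks. -/
def Gen.map {J' : I → Type*} (e : ∀ i, J' i → J i) (g : Gen P J') : Gen P J :=
  ⟨g.1, Sum.map id (fun q => (toLex (e g.1 (ofLex q.1).1, (ofLex q.1).2), q.2)) g.2⟩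

theorem lex_map_strictMonoOn {α : Type*} {β : Type*} {γ : Type*} [LinearOrder α] [LinearOrder β]
    [LinearOrder γ] {f : α → β} {s : Set α} (hf : StrictMonoOn f s) :
    StrictMonoOn (fun p : α ×ₗ γ => (toLex (f (ofLex p).1, (ofLex p).2) : β ×ₗ γ))
      {p | (ofLex p).1 ∈ s} := by
  intro p hp q hq hpq
  rw [Prod.Lex.lt_iff] at hpq ⊢
  rcases hpq with h | ⟨h1, h2⟩
  · exact Or.inl (hf hp hq h)
  · exact Or.inr ⟨by simp only [ofLex_toLex, h1], h2⟩

theorem lex_map_strictMono {α : Type*} {β : Type*} {γ : Type*} [LinearOrder α] [LinearOrder β]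
    [LinearOrder γ] {f : α → β} (hf : StrictMono f) :
    StrictMono (fun p : α ×ₗ γ => (toLex (f (ofLex p).1, (ofLex p).2) : β ×ₗ γ)) :=
  fun _ _ hpq => lex_map_strictMonoOn (hf.strictMonoOn Set.univ) trivial trivial hpq

theorem exists_strictMonoOn_nat {α : Type*} [LinearOrder α] (D : Finset α) :
    ∃ g : α → ℕ, StrictMonoOn g (D : Set α) := by
  refine ⟨fun a => (D.filter (· < a)).card, fun a ha b _ hab => Finset.card_lt_card ?_⟩
  refine Finset.ssubset_iff_subset_ne.2 ⟨fun x hx => ?_, fun h => ?_⟩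
  · rw [Finset.mem_filter] at hx ⊢
    exact ⟨hx.1, hx.2.trans hab⟩
  · have : a ∈ D.filter (· < b) := Finset.mem_filter.2 ⟨ha, hab⟩
    rw [← h] at this
    exact lt_irrefl _ (Finset.mem_filter.1 this).2

end System

/-- Stretching: the sequences in a system can be given any length. -/
theorem IsSystem.stretch {m : ℕ} {I : Type (max u v)} [LinearOrder I] {P : I → Pattern L m}
    {N : Type (max u v)} [L.Structure N] [Nonempty N] {z : Gen P (fun _ => ℕ) → N} {c : Fin m → N}
    (h : IsSystem P (fun _ => ℕ) z c) (J : I → Type (max u v)) [∀ i, LinearOrder (J i)] :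
    ∃ (N' : Type (max u v)) (_ : L.Structure N') (f : N ↪ₑ[L] N') (z' : Gen P J → N'),
      IsSystem P J z' (f ∘ c) := by
  classical
  let Adm (D : Finset (Σ i, J i)) (g : ∀ i, J i → ℕ) : Prop :=
    ∀ i, StrictMonoOn (g i) {ξ | (⟨i, ξ⟩ : Σ i, J i) ∈ D}
  -- `S` collects what holds whenever blocks are renamed by natural numbers in a way that is
  -- increasing on a suitable finite set `D`. Finitely many such sets are served by one renaming,
  -- whence finite satisfiability.
  let S : Set (L.Formula (Fin m ⊕ Gen P J)) := {ψ | ∃ D, ∀ g, Adm D g →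
    ψ.Realize (Sum.elim c (z ∘ Gen.map g))}
  have hS : FinSat c S := by
    intro F hF
    choose! D hD using hF
    have : ∀ i, ∃ g : J i → ℕ, StrictMonoOn g {ξ | (⟨i, ξ⟩ : Σ i, J i) ∈ F.biUnion D} := by
      intro i
      obtain ⟨g, hg⟩ := exists_strictMonoOn_nat
        ((F.biUnion D).preimage (fun ξ : J i => (⟨i, ξ⟩ : Σ i, J i))
          (sigma_mk_injective.injOn))
      exact ⟨g, by simpa [Finset.coe_preimage, Set.preimage] using hg⟩
    choose g hg using this
    refine ⟨z ∘ Gen.map g, fun ψ hψ => hD hψ g fun i => (hg i).mono fun ξ hξ => ?_⟩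
    exact Finset.mem_biUnion.2 ⟨ψ, hψ, hξ⟩
  obtain ⟨N', _, f, z', hz'⟩ := exists_realization c S hS
  have hreal : ∀ ψ : L.Formula (Gen P J ⊕ Fin m), (∃ D, ∀ g, Adm D g →
      ψ.Realize (Sum.elim (z ∘ Gen.map g) c)) → ψ.Realize (Sum.elim z' (f ∘ c)) := by
    rintro ψ ⟨D, hD⟩
    have h1 : ∀ (M : Type (max u v)) [L.Structure M] (a : Fin m → M) (b : Gen P J → M),
        (FirstOrder.Language.Formula.relabel Sum.swap ψ).Realize (Sum.elim a b) ↔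
          ψ.Realize (Sum.elim b a) := by
      intro M _ a b
      rw [FirstOrder.Language.Formula.realize_relabel]
      congr! 1
      funext x
      rcases x with x | x <;> rfl
    exact (h1 _ _ _).1 (hz' _ ⟨D, fun g hg => (h1 _ _ _).2 (hD g hg)⟩)
  refine ⟨N', inferInstance, f, z', ?_, ?_, ?_⟩
  · intro i r ψ s t hs ht
    have := hreal ((ψ.relabel (Sum.elim (fun g => Sum.inl g.1)
        fun q => Sum.inl ⟨i, Sum.inr (s q.1, q.2)⟩)).imp
      (ψ.relabel (Sum.elim (fun g => Sum.inl g.1)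
        fun q => Sum.inl ⟨i, Sum.inr (t q.1, q.2)⟩)))
      ⟨(Finset.univ.image fun q => ⟨i, (ofLex (s q)).1⟩) ∪
        (Finset.univ.image fun q => ⟨i, (ofLex (t q)).1⟩), ?_⟩
    · simp only [FirstOrder.Language.Formula.realize_imp,
        FirstOrder.Language.Formula.realize_relabel, Sum.comp_elim] at this
      exact this
    · intro g hg
      simp only [FirstOrder.Language.Formula.realize_imp,
        FirstOrder.Language.Formula.realize_relabel, Sum.comp_elim]
      have hm := lex_map_strictMonoOn (γ := Fin ((P i).R + 1)) (hg i)
      have hb := (h.indisc i).of_range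
        (g' := fun x : {x : Gen P J // x.1 < i} => z (Gen.map g x.1))
        (fun x => ⟨⟨Gen.map g x.1, x.2⟩, rfl⟩)
      refine hb r ψ _ _ (fun p q hpq => hm ?_ ?_ (hs hpq)) (fun p q hpq => hm ?_ ?_ (ht hpq))
      all_goals simp
  · intro i ξ
    refine (realize_impFormula P i ξ z' (f ∘ c)).1 (hreal _ ⟨∅, fun g _ => ?_⟩)
    exact (realize_impFormula P i ξ _ c).2 (h.imp i (g i ξ))
  · intro i
    have := hreal ((P i).φ.relabel (Sum.elim Sum.inr fun l => Sum.inl ⟨i, Sum.inl l⟩))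
      ⟨∅, fun g _ => ?_⟩
    · simp only [FirstOrder.Language.Formula.realize_relabel, Sum.comp_elim] at this
      exact this
    · simp only [FirstOrder.Language.Formula.realize_relabel, Sum.comp_elim]
      exact h.sat i

/-- `T` has a system of length `κ` in `m` variables. -/
def HasSystem (T : L.Theory) (m : ℕ) (κ : Cardinal.{max u v}) : Prop :=
  ∃ (N : Type (max u v)) (_ : L.Structure N) (P : κ.ord.ToType → Pattern L m)
    (z : Gen P (fun _ => ℕ) → N) (c : Fin m → N),
    Nonempty N ∧ N ⊨ T ∧ IsSystem P (fun _ => ℕ) z c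

/-- The sets `A i` stand in for the earlier elements: it is enough that `A j` contains the data of
every i < j and that the i-th sequence is indiscernible over `A i`. -/
theorem hasSystem_of_sets {T : L.Theory} {m : ℕ} {κ : Cardinal.{max u v}}
    {N : Type (max u v)} [L.Structure N] [Nonempty N] (hT : N ⊨ T)
    (A : κ.ord.ToType → Set N) (c : Fin m → N)
    (H : ∀ i, ∃ (P : Pattern L m) (a : Fin P.k → N) (b : ℕ → Fin (P.R + 1) → Fin P.n → N),
      (∀ j, i < j → (∀ l, a l ∈ A j) ∧ ∀ ξ q l, b ξ q l ∈ A j) ∧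
      Indisc L (Subtype.val : A i → N)
        (fun p : ℕ ×ₗ Fin (P.R + 1) => b (ofLex p).1 (ofLex p).2) ∧
      (∀ ξ (d : Fin m → N), P.φ.Realize (Sum.elim d a) →
        P.Ψ.Realize (Sum.elim d fun q => b ξ q.1 q.2)) ∧
      P.φ.Realize (Sum.elim c a)) : HasSystem T m κ := by
  choose P a b hA hb himp hsat using H
  let z : Gen P (fun _ => ℕ) → N := fun g => Sum.elim (a g.1)
    (fun q => b g.1 (ofLex q.1).1 (ofLex q.1).2 q.2) g.2
  refine ⟨N, inferInstance, P, z, c, inferInstance, hT, ?_, himp, hsat⟩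
  intro i
  refine (hb i).of_range ?_
  rintro ⟨⟨j, l | ⟨p, l⟩⟩, hj⟩
  · exact ⟨⟨_, (hA j i hj).1 l⟩, rfl⟩
  · exact ⟨⟨_, (hA j i hj).2 (ofLex p).1 (ofLex p).2 l⟩, rfl⟩

/-! ### Indiscernibility in an expanded language -/

section Expansion

variable {L' : FirstOrder.Language.{u', v'}} (ι : L →ᴸ L') {m : ℕ} {I : Type w} [LinearOrder I]
  {P : I → Pattern L m} {J : I → Type x} [∀ i, LinearOrder (J i)]

/-- `z'` has (at least) the `L`-type of `z`, and the sequences with index in `F` are indiscernible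
in the sense of `L'`. -/
structure IsPartialExpansion {N : Type y} [L.Structure N] (z : Gen P J ⊕ Fin m → N) (F : Set I)
    {N' : Type*} [L'.Structure N'] (z' : Gen P J ⊕ Fin m → N') : Prop where
  realize : ∀ ψ : L.Formula (Gen P J ⊕ Fin m), ψ.Realize z → (ι.onFormula ψ).Realize z'
  indisc : ∀ i ∈ F, Indisc L' (fun g : {g : Gen P J // g.1 < i} => z' (Sum.inl g.1))
    (fun p l => z' (Sum.inl ⟨i, Sum.inr (p, l)⟩))

variable {N : Type (max u' v')} [L.Structure N] {z : Gen P J ⊕ Fin m → N}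

/-- The finite approximation needed to make the i-th sequence `L'`-indiscernible. Ramsey's theorem
moves the finitely many positions in `D` to positions where `z₁` is homogeneous for `Φ`. By
`L`-indiscernibility of the original sequence this move is harmless for `L`-formulas over the names
below `i`, so the remaining names can be reinterpreted to satisfy `Θ`. -/
theorem IsPartialExpansion.exists_amalgam [Nonempty N] [∀ i, Nonempty (J i)] [∀ i, NoMaxOrder (J i)]
    {i : I}
    (hz : Indisc L (fun g : {g : Gen P J // g.1 < i} => z (Sum.inl g.1))
      (fun p l => z (Sum.inl ⟨i, Sum.inr (p, l)⟩)))
    {F : Set I} {N₁ : Type (max u' v')} [L'.Structure N₁] [Nonempty N₁]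
    {z₁ : Gen P J ⊕ Fin m → N₁} (h : IsPartialExpansion ι z F z₁)
    (D : Finset (J i ×ₗ Fin ((P i).R + 1)))
    (Φ : Finset (Σ r, L'.Formula ({g : Gen P J // g.1 < i} ⊕ Fin r × Fin (P i).n)))
    (Θ : Finset (L.Formula (Gen P J ⊕ Fin m))) (hΘ : ∀ θ ∈ Θ, θ.Realize z) :
    ∃ z₂ : Gen P J ⊕ Fin m → N₁, (∀ g : Gen P J, g.1 < i → z₂ (Sum.inl g) = z₁ (Sum.inl g)) ∧
      (∀ θ ∈ Θ, (ι.onFormula θ).Realize z₂) ∧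
      ∀ φ ∈ Φ, ∀ s t : Fin φ.1 → J i ×ₗ Fin ((P i).R + 1), StrictMono s → StrictMono t →
        (∀ q, s q ∈ D) → (∀ q, t q ∈ D) →
        φ.2.Realize (Sum.elim (fun g => z₁ (Sum.inl g.1))
          fun q => z₂ (Sum.inl ⟨i, Sum.inr (s q.1, q.2)⟩)) →
        φ.2.Realize (Sum.elim (fun g => z₁ (Sum.inl g.1))
          fun q => z₂ (Sum.inl ⟨i, Sum.inr (t q.1, q.2)⟩)) := by
  classical
  let _ : L.Structure N₁ := ι.reduct N₁
  have _ : ι.IsExpansionOn N₁ := ι.isExpansionOn_reduct N₁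
  obtain ⟨e₀, he₀⟩ := Nat.exists_strictMono (J i)
  let e : ℕ → J i ×ₗ Fin ((P i).R + 1) := fun k => toLex (e₀ k, 0)
  have he : StrictMono e := fun a b hab => Prod.Lex.lt_iff.2 (Or.inl (he₀ hab))
  obtain ⟨h', hh', hom⟩ := exists_homogeneous_finset Φ (fun φ => φ.1) (fun φ u =>
    φ.2.Realize (Sum.elim (fun g => z₁ (Sum.inl g.1))
          fun q => z₁ (Sum.inl ⟨i, Sum.inr (e (u q.1), q.2)⟩)))
  obtain ⟨G, hG⟩ := exists_strictMonoOn_nat D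
  let σ : J i ×ₗ Fin ((P i).R + 1) → J i ×ₗ Fin ((P i).R + 1) := fun p => e (h' (G p))
  have hσ : StrictMonoOn σ D := fun a ha b hb hab => he (hh' (hG ha hb hab))
  let s₀ := D.orderEmbOfFin rfl
  let θ := FirstOrder.Language.Formula.iInf (fun θ : Θ => θ.1)
  have hθ : ∀ {M : Type (max u' v')} [L.Structure M] (a : Gen P J ⊕ Fin m → M),
      θ.Realize a ↔ ∀ θ ∈ Θ, θ.Realize a := by
    intro M _ a
    simp [θ, FirstOrder.Language.Formula.realize_iInf]
  -- `ρ` separates the names below `i` and the terms at positions in `D`, whose values are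
  -- prescribed, from all other names and variables, which are quantified existentially.
  let ρ : Gen P J ⊕ Fin m →
      ({g : Gen P J // g.1 < i} ⊕ Fin D.card × Fin (P i).n) ⊕ (Gen P J ⊕ Fin m) := fun a =>
    if hW : ∃ g : {g : Gen P J // g.1 < i}, a = Sum.inl g.1 then Sum.inl (Sum.inl hW.choose)
    else if hD : ∃ q : Fin D.card × Fin (P i).n, a = Sum.inl ⟨i, Sum.inr (s₀ q.1, q.2)⟩ then
      Sum.inl (Sum.inr hD.choose)
    else Sum.inr a
  have hρW : ∀ g : {g : Gen P J // g.1 < i}, ρ (Sum.inl g.1) = Sum.inl (Sum.inl g) := by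
    intro g
    have hW : ∃ g' : {g : Gen P J // g.1 < i},
      (Sum.inl g.1 : Gen P J ⊕ Fin m) = Sum.inl g'.1 := ⟨g, rfl⟩
    simp only [ρ, dif_pos hW]
    exact congrArg _ (congrArg _ (Subtype.ext (Sum.inl_injective hW.choose_spec).symm))
  have hρD : ∀ q : Fin D.card × Fin (P i).n,
      ρ (Sum.inl ⟨i, Sum.inr (s₀ q.1, q.2)⟩) = Sum.inl (Sum.inr q) := by
    intro q
    have hW : ¬ ∃ g' : {g : Gen P J // g.1 < i},
        (Sum.inl ⟨i, Sum.inr (s₀ q.1, q.2)⟩ : Gen P J ⊕ Fin m) = Sum.inl g'.1 := by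
      rintro ⟨⟨g, hg⟩, h⟩
      obtain rfl := Sum.inl_injective h
      exact lt_irrefl _ hg
    have hD : ∃ q' : Fin D.card × Fin (P i).n,
      (Sum.inl ⟨i, Sum.inr (s₀ q.1, q.2)⟩ : Gen P J ⊕ Fin m) =
        Sum.inl ⟨i, Sum.inr (s₀ q'.1, q'.2)⟩ := ⟨q, rfl⟩
    simp only [ρ, dif_neg hW, dif_pos hD]
    have h1 := hD.choose_spec
    generalize hD.choose = q' at h1
    have h2 : (s₀ q.1, q.2) = (s₀ q'.1, q'.2) := by
      simpa using h1
    rw [Prod.mk.injEq] at h2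
    exact congrArg _ (congrArg _ (Prod.ext (s₀.injective h2.1) h2.2).symm)
  obtain ⟨θ', hθ'⟩ := exists_projection.{u, v, _, _, max u' v'} (θ.relabel ρ)
  have h1 : θ'.Realize (Sum.elim (fun g => z (Sum.inl g.1))
      fun q => z (Sum.inl ⟨i, Sum.inr (s₀ q.1, q.2)⟩)) := by
    rw [hθ']
    refine ⟨z, ?_⟩
    rw [FirstOrder.Language.Formula.realize_relabel]
    have : (Sum.elim (Sum.elim (fun g : {g : Gen P J // g.1 < i} => z (Sum.inl g.1))
        fun q : Fin D.card × Fin (P i).n => z (Sum.inl ⟨i, Sum.inr (s₀ q.1, q.2)⟩)) z) ∘ ρ = z := by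
      funext a
      by_cases hW : ∃ g : {g : Gen P J // g.1 < i}, a = Sum.inl g.1
      · obtain ⟨g, rfl⟩ := hW
        rw [Function.comp_apply, hρW]; rfl
      · by_cases hD : ∃ q : Fin D.card × Fin (P i).n, a = Sum.inl ⟨i, Sum.inr (s₀ q.1, q.2)⟩
        · obtain ⟨q, rfl⟩ := hD
          rw [Function.comp_apply, hρD]; rfl
        · simp only [ρ, Function.comp_apply, dif_neg hW, dif_neg hD]; rfl
    rw [this, hθ]
    exact hΘ
  have hs₀ : ∀ q, s₀ q ∈ D := fun q => D.orderEmbOfFin_mem rfl q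
  -- Indiscernibility of the original sequence carries the existential `L`-formula from the
  -- positions in `D` to the homogeneous ones; the type of `z` then carries it to `z₁`.
  have h2 := hz D.card θ' s₀ (σ ∘ s₀) s₀.strictMono
    (fun a b hab => hσ (hs₀ a) (hs₀ b) (s₀.strictMono hab)) h1
  have h3 := h.realize (θ'.relabel (Sum.elim (fun g => Sum.inl g.1)
      fun q => Sum.inl ⟨i, Sum.inr ((σ ∘ s₀) q.1, q.2)⟩))
  rw [ι.realize_onFormula, FirstOrder.Language.Formula.realize_relabel,
    FirstOrder.Language.Formula.realize_relabel, Sum.comp_elim, Sum.comp_elim] at h3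
  obtain ⟨y, hy⟩ := (hθ' N₁ _).1 (h3 h2)
  rw [FirstOrder.Language.Formula.realize_relabel, hθ] at hy
  refine ⟨_, fun g hg => ?_, fun θ hθ => (ι.realize_onFormula θ).2 (hy θ hθ), ?_⟩
  · rw [Function.comp_apply, hρW ⟨g, hg⟩]; rfl
  · intro φ hφ s t hs ht hsD htD
    have h4 := hom φ hφ (G ∘ s) (G ∘ t) (fun a b hab => hG (hsD a) (hsD b) (hs hab))
      (fun a b hab => hG (htD a) (htD b) (ht hab))
    have hval : ∀ p (hp : p ∈ D) l, ρ (Sum.inl ⟨i, Sum.inr (p, l)⟩) =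
        Sum.inl (Sum.inr ((D.orderIsoOfFin rfl).symm ⟨p, hp⟩, l)) := by
      intro p hp l
      have := hρD ((D.orderIsoOfFin rfl).symm ⟨p, hp⟩, l)
      rw [← this]
      simp [s₀, ← Finset.coe_orderIsoOfFin_apply]
    have hval' : ∀ p (hp : p ∈ D), s₀ ((D.orderIsoOfFin rfl).symm ⟨p, hp⟩) = p := by
      intro p hp
      simp [s₀, ← Finset.coe_orderIsoOfFin_apply]
    simp only [Function.comp_apply, hval _ (hsD _), hval _ (htD _), Sum.elim_inl, Sum.elim_inr,
      hval']
    exact h4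

/-- Compactness applied to `exists_amalgam`. The sequences treated before stay indiscernible because
the names below `i` keep their values up to an elementary embedding, and for j < i only such names
are involved. -/
theorem IsPartialExpansion.insert [Nonempty N] [∀ i, Nonempty (J i)] [∀ i, NoMaxOrder (J i)]
    {i : I}
    (hz : Indisc L (fun g : {g : Gen P J // g.1 < i} => z (Sum.inl g.1))
      (fun p l => z (Sum.inl ⟨i, Sum.inr (p, l)⟩)))
    {F : Set I} (hF : ∀ j ∈ F, j < i) {N₁ : Type (max u' v')} [L'.Structure N₁] [Nonempty N₁]
    {z₁ : Gen P J ⊕ Fin m → N₁} (h : IsPartialExpansion ι z F z₁) :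
    ∃ (N₂ : Type (max u' v' w x)) (_ : L'.Structure N₂) (_ : N₁ ↪ₑ[L'] N₂)
      (z₂ : Gen P J ⊕ Fin m → N₂), IsPartialExpansion ι z (insert i F) z₂ := by
  classical
  let Adm (D : Finset (J i ×ₗ Fin ((P i).R + 1)))
      (Φ : Finset (Σ r, L'.Formula ({g : Gen P J // g.1 < i} ⊕ Fin r × Fin (P i).n)))
      (Θ : Finset (L.Formula (Gen P J ⊕ Fin m))) (z₂ : Gen P J ⊕ Fin m → N₁) : Prop :=
    (∀ g : Gen P J, g.1 < i → z₂ (Sum.inl g) = z₁ (Sum.inl g)) ∧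
      (∀ θ ∈ Θ, θ.Realize z → (ι.onFormula θ).Realize z₂) ∧
      ∀ φ ∈ Φ, ∀ s t : Fin φ.1 → J i ×ₗ Fin ((P i).R + 1), StrictMono s → StrictMono t →
        (∀ q, s q ∈ D) → (∀ q, t q ∈ D) →
        φ.2.Realize (Sum.elim (fun g => z₁ (Sum.inl g.1))
          fun q => z₂ (Sum.inl ⟨i, Sum.inr (s q.1, q.2)⟩)) →
        φ.2.Realize (Sum.elim (fun g => z₁ (Sum.inl g.1))
          fun q => z₂ (Sum.inl ⟨i, Sum.inr (t q.1, q.2)⟩))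
  let g₁ : {g : Gen P J // g.1 < i} → N₁ := fun g => z₁ (Sum.inl g.1)
  let S : Set (L'.Formula ({g : Gen P J // g.1 < i} ⊕ (Gen P J ⊕ Fin m))) :=
    {ψ | ∃ D Φ Θ, ∀ z₂, Adm D Φ Θ z₂ → ψ.Realize (Sum.elim g₁ z₂)}
  have hS : FinSat g₁ S := by
    intro F hF
    choose! D Φ Θ hD using hF
    obtain ⟨z₂, h1, h2, h3⟩ := h.exists_amalgam ι hz (F.biUnion D) (F.biUnion Φ)
      ((F.biUnion Θ).filter fun θ => θ.Realize z) (fun θ hθ => (Finset.mem_filter.1 hθ).2)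
    refine ⟨z₂, fun ψ hψ => hD hψ z₂ ⟨h1, fun θ hθ hr => h2 θ (Finset.mem_filter.2
      ⟨Finset.mem_biUnion.2 ⟨ψ, hψ, hθ⟩, hr⟩), fun φ hφ s t hs ht hsD htD => ?_⟩⟩
    exact h3 φ (Finset.mem_biUnion.2 ⟨ψ, hψ, hφ⟩) s t hs ht
      (fun q => Finset.mem_biUnion.2 ⟨ψ, hψ, hsD q⟩) (fun q => Finset.mem_biUnion.2 ⟨ψ, hψ, htD q⟩)
  obtain ⟨N₂, _, f, z₂, hz₂⟩ := exists_realization g₁ S hS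
  have heq : ∀ g : Gen P J, g.1 < i → z₂ (Sum.inl g) = f (z₁ (Sum.inl g)) := by
    intro g hg
    have := hz₂ ((FirstOrder.Language.Term.var (Sum.inr (Sum.inl g))).equal
      (FirstOrder.Language.Term.var (Sum.inl ⟨g, hg⟩))) ⟨∅, ∅, ∅, fun z₂ hz₂ => ?_⟩
    · simpa [FirstOrder.Language.Formula.realize_equal] using this
    · simpa [FirstOrder.Language.Formula.realize_equal, g₁] using hz₂.1 g hg
  refine ⟨N₂, inferInstance, f, z₂, fun ψ hψ => ?_, fun j hj => ?_⟩
  · have := hz₂ ((ι.onFormula ψ).relabel Sum.inr) ⟨∅, ∅, {ψ}, fun z₂ hz₂ => ?_⟩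
    · rwa [FirstOrder.Language.Formula.realize_relabel, Sum.elim_comp_inr] at this
    · rw [FirstOrder.Language.Formula.realize_relabel, Sum.elim_comp_inr]
      exact hz₂.2.1 ψ (Finset.mem_singleton_self _) hψ
  · by_cases hji : j < i
    · have hjF : j ∈ F := hj.resolve_left hji.ne
      have h1 := (h.indisc j hjF).map f
      convert h1 using 1
      · funext g
        exact heq g.1 (g.2.trans hji)
      · funext p l
        exact heq _ hji
    · obtain rfl : j = i := hj.resolve_right fun h => hji (hF j h)
      intro r ψ s t hs ht hψ
      have := hz₂ ((ψ.relabel (Sum.elim Sum.inl fun q =>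
          Sum.inr (Sum.inl ⟨j, Sum.inr (s q.1, q.2)⟩))).imp
        (ψ.relabel (Sum.elim Sum.inl fun q =>
          Sum.inr (Sum.inl ⟨j, Sum.inr (t q.1, q.2)⟩))))
        ⟨Finset.univ.image s ∪ Finset.univ.image t, {⟨r, ψ⟩}, ∅, fun z₂ hz₂ => ?_⟩
      · simp only [FirstOrder.Language.Formula.realize_imp,
          FirstOrder.Language.Formula.realize_relabel, Sum.comp_elim] at this
        have hg : (fun g : {g : Gen P J // g.1 < j} => z₂ (Sum.inl g.1)) = f ∘ g₁ :=
          funext fun g => heq g.1 g.2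
        rw [hg] at hψ ⊢
        exact this hψ
      · simp only [FirstOrder.Language.Formula.realize_imp,
          FirstOrder.Language.Formula.realize_relabel, Sum.comp_elim]
        exact hz₂.2.2 ⟨r, ψ⟩ (Finset.mem_singleton_self _) s t hs ht (by simp) (by simp)

end Expansion

/-- The sequences of a system can be made indiscernible in the sense of an expanded language. -/
theorem exists_expansion {L' : FirstOrder.Language.{u', v'}} (ι : L →ᴸ L') {m : ℕ}
    {I : Type (max u' v')} [LinearOrder I]
    {P : I → Pattern L m} {J : I → Type (max u' v')} [∀ i, LinearOrder (J i)]
    [∀ i, Nonempty (J i)] [∀ i, NoMaxOrder (J i)]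
    {N : Type (max u' v')} [L.Structure N] [L'.Structure N] [ι.IsExpansionOn N] [Nonempty N]
    {z : Gen P J → N} {c : Fin m → N} (h : IsSystem P J z c) :
    ∃ (N' : Type (max u' v')) (_ : L'.Structure N') (_ : N ↪ₑ[L'] N')
      (z' : Gen P J ⊕ Fin m → N'),
      IsPartialExpansion ι (Sum.elim z c) Set.univ z' := by
  classical
  have key : ∀ F : Finset I, ∃ (N' : Type (max u' v')) (_ : L'.Structure N') (_ : N ↪ₑ[L'] N')
      (z' : Gen P J ⊕ Fin m → N'), IsPartialExpansion ι (Sum.elim z c) (F : Set I) z' := by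
    intro F
    -- The indices are treated in increasing order, since treating one changes the interpretation of
    -- the names at and above it.
    induction F using Finset.induction_on_max with
    | empty =>
      exact ⟨N, inferInstance, FirstOrder.Language.ElementaryEmbedding.refl L' N, Sum.elim z c,
        fun ψ hψ => (ι.realize_onFormula ψ).2 hψ, by simp⟩
    | insert i F hi ih =>
      obtain ⟨N₁, _, f, z₁, h₁⟩ := ih
      have : Nonempty N₁ := ‹Nonempty N›.map f
      obtain ⟨N₂, _, f₂, z₂, h₂⟩ := h₁.insert ι (h.indisc i) hi
      exact ⟨N₂, inferInstance, f₂.comp f, z₂, by rwa [Finset.coe_insert]⟩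
  let S : Set (L'.Formula (Empty ⊕ (Gen P J ⊕ Fin m))) :=
    {ψ | ∃ F : Finset I, ∀ (N' : Type (max u' v')) [L'.Structure N'] (z' : Gen P J ⊕ Fin m → N'),
      IsPartialExpansion ι (Sum.elim z c) (F : Set I) z' → ψ.Realize (Sum.elim Empty.elim z')}
  have hS : FinSat (Empty.elim : Empty → N) S := by
    intro Φ hΦ
    choose! F hF using hΦ
    obtain ⟨N', _, f, z', h'⟩ := key (Φ.biUnion F)
    have : Nonempty N' := ‹Nonempty N›.map f
    -- The extension found depends on the finite set of indices. Pulling an existential sentence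
    -- back to `N` brings all approximations into one model, as compactness requires.
    obtain ⟨θ, hθ⟩ := exists_projection.{u', v', _, _, max u' v'}
      (FirstOrder.Language.Formula.iInf (fun ψ : Φ => ψ.1))
    have h1 : θ.Realize (f ∘ Empty.elim) := by
      rw [hθ]
      refine ⟨z', ?_⟩
      rw [FirstOrder.Language.Formula.realize_iInf]
      rintro ⟨ψ, hψ⟩
      rw [show (f ∘ Empty.elim : Empty → N') = Empty.elim from funext fun e => e.elim]
      exact hF hψ N' z' ⟨h'.realize, fun i hi => h'.indisc i
        (Finset.mem_coe.2 (Finset.mem_biUnion.2 ⟨ψ, hψ, hi⟩))⟩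
    rw [f.map_formula, hθ] at h1
    obtain ⟨y, hy⟩ := h1
    rw [FirstOrder.Language.Formula.realize_iInf] at hy
    exact ⟨y, fun ψ hψ => hy ⟨ψ, hψ⟩⟩
  obtain ⟨N', _, f, z', hz'⟩ := exists_realization _ S hS
  have hE : (f ∘ Empty.elim : Empty → N') = Empty.elim := funext fun e => e.elim
  rw [hE] at hz'
  refine ⟨N', inferInstance, f, z', fun ψ hψ => ?_, fun i _ r ψ s t hs ht => ?_⟩
  · have := hz' ((ι.onFormula ψ).relabel Sum.inr) ⟨∅, fun M _ y hy => ?_⟩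
    · rwa [FirstOrder.Language.Formula.realize_relabel, Sum.elim_comp_inr] at this
    · rw [FirstOrder.Language.Formula.realize_relabel, Sum.elim_comp_inr]
      exact hy.realize ψ hψ
  · have := hz' ((ψ.relabel (Sum.elim (fun g => Sum.inr (Sum.inl g.1)) fun q =>
          Sum.inr (Sum.inl ⟨i, Sum.inr (s q.1, q.2)⟩))).imp
        (ψ.relabel (Sum.elim (fun g => Sum.inr (Sum.inl g.1)) fun q =>
          Sum.inr (Sum.inl ⟨i, Sum.inr (t q.1, q.2)⟩)))) ⟨{i}, fun M _ y hy => ?_⟩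
    · simp only [FirstOrder.Language.Formula.realize_imp,
          FirstOrder.Language.Formula.realize_relabel, Sum.comp_elim] at this
      exact this
    · simp only [FirstOrder.Language.Formula.realize_imp,
          FirstOrder.Language.Formula.realize_relabel, Sum.comp_elim]
      exact hy.indisc i (by simp) r ψ s t hs ht

/-! ### Lengths of sequences -/

theorem exists_forall_lt_of_card_lt {κ : Cardinal.{w}} (hκ : κ.IsRegular) {X : Type w}
    (hX : #X < κ) (g : X → κ.ord.ToType) : ∃ j, ∀ x, g x < j := by
  by_contra! h
  have hc : IsCofinal (Set.range g) := fun j => by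
    obtain ⟨x, hx⟩ := h j
    exact ⟨g x, ⟨x, rfl⟩, hx⟩
  have h1 := Order.cof_le hc
  rw [Ordinal.cof_toType, hκ.cof_ord] at h1
  exact (h1.trans Cardinal.mk_range_le).not_gt hX

/-- The position of an element of `κ.ord.ToType`. -/
noncomputable def pos {o : Ordinal.{w}} (i : o.ToType) : Ordinal.{w} :=
  (Ordinal.ToType.mk.symm i).1

theorem pos_lt {o : Ordinal.{w}} (i : o.ToType) : pos i < o := (Ordinal.ToType.mk.symm i).2

theorem pos_lt_pos {o : Ordinal.{w}} {i j : o.ToType} : pos i < pos j ↔ i < j := by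
  rw [pos, pos, Subtype.coe_lt_coe, OrderIso.lt_iff_lt]

theorem pos_mk {o : Ordinal.{w}} (α : Set.Iio o) : pos (Ordinal.ToType.mk α) = α := by
  simp [pos]

/-- The length of the `i`-th sequence in the stretched systems used below. -/
noncomputable def len (ν : Ordinal.{w}) {o : Ordinal.{w}} (i : o.ToType) : Cardinal.{w} :=
  Order.succ (ℵ_ (ν + pos i))

theorem aleph0_le_len (ν : Ordinal.{w}) {o : Ordinal.{w}} (i : o.ToType) : ℵ₀ ≤ len ν i :=
  (Cardinal.aleph0_le_aleph _).trans (Order.le_succ _)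

theorem isRegular_len (ν : Ordinal.{w}) {o : Ordinal.{w}} (i : o.ToType) : (len ν i).IsRegular :=
  Cardinal.isRegular_succ (Cardinal.aleph0_le_aleph _)

/-- Index sets for the stretched sequences. -/
abbrev LenIdx (ν : Ordinal.{w}) {o : Ordinal.{w}} (i : o.ToType) : Type w := (len ν i).ord.ToType

instance (ν : Ordinal.{w}) {o : Ordinal.{w}} (i : o.ToType) : NoMaxOrder (LenIdx ν i) :=
  Cardinal.noMaxOrder (aleph0_le_len ν i)

instance (ν : Ordinal.{w}) {o : Ordinal.{w}} (i : o.ToType) : Nonempty (LenIdx ν i) := by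
  rw [← Cardinal.mk_ne_zero_iff, Cardinal.mk_ord_toType]
  exact (Cardinal.aleph0_pos.trans_le (aleph0_le_len ν i)).ne'

/-- The j-th sequence has ℵ_(ν+j+1) blocks, which is at most ℵ_(ν+o) for j < o. Thus the elements
before the i-th sequence are fewer than its length ℵ_(ν+i)⁺. -/
theorem mk_gen_lt_le {m : ℕ} {κ : Cardinal.{max u v}} {ν : Ordinal.{max u v}} (hκ : κ ≤ ℵ_ ν)
    (P : κ.ord.ToType → Pattern L m) (o : Ordinal.{max u v}) :
    #{g : Gen P (LenIdx ν) // pos g.1 < o} ≤ ℵ_ (ν + o) := by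
  let f : {g : Gen P (LenIdx ν) // pos g.1 < o} → Σ j : {j : κ.ord.ToType // pos j < o},
      Fin (P j).k ⊕ (LenIdx ν j.1 ×ₗ Fin ((P j).R + 1)) × Fin (P j).n := fun g =>
    ⟨⟨g.1.1, g.2⟩, g.1.2⟩
  have hf : Function.Injective f := by
    rintro ⟨⟨i, a⟩, hi⟩ ⟨⟨j, b⟩, hj⟩ h
    simp only [f, Sigma.mk.injEq, Subtype.mk.injEq] at h
    obtain ⟨rfl, h⟩ := h
    simpa using h
  refine (Cardinal.mk_le_of_injective hf).trans ?_
  rw [Cardinal.mk_sigma]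
  have h0 : ℵ₀ ≤ ℵ_ (ν + o) := Cardinal.aleph0_le_aleph _
  have h1 : ∀ j : {j : κ.ord.ToType // pos j < o},
      #(Fin (P j).k ⊕ (LenIdx ν j.1 ×ₗ Fin ((P j).R + 1)) × Fin (P j).n) ≤ ℵ_ (ν + o) := by
    intro j
    have hl : #(LenIdx ν j.1) ≤ ℵ_ (ν + o) := by
      rw [Cardinal.mk_ord_toType, len, Cardinal.succ_aleph, Cardinal.aleph_le_aleph, add_assoc]
      exact add_le_add_right (Order.add_one_le_of_lt j.2) _
    have hlex : #(LenIdx ν j.1 ×ₗ Fin ((P j).R + 1)) = #(LenIdx ν j.1 × Fin ((P j).R + 1)) := rfl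
    have hfin : ∀ n : ℕ, (n : Cardinal.{max u v}) ≤ ℵ_ (ν + o) := fun n =>
      (Cardinal.natCast_lt_aleph0).le.trans h0
    simp only [Cardinal.mk_sum, Cardinal.mk_prod, hlex, Cardinal.mk_fin, Cardinal.lift_natCast,
      Cardinal.lift_uzero]
    exact Cardinal.add_le_of_le h0 (hfin _)
      (Cardinal.mul_le_of_le h0 (Cardinal.mul_le_of_le h0 hl (hfin _)) (hfin _))
  refine (Cardinal.sum_le_sum _ _ h1).trans ?_
  rw [Cardinal.sum_const, Cardinal.lift_id, Cardinal.lift_id]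
  refine Cardinal.mul_le_of_le h0 ?_ le_rfl
  calc #{j : κ.ord.ToType // pos j < o} ≤ #κ.ord.ToType := Cardinal.mk_subtype_le _
    _ = κ := Cardinal.mk_ord_toType κ
    _ ≤ ℵ_ ν := hκ
    _ ≤ _ := Cardinal.aleph_le_aleph.2 le_self_add

/-! ### Skolem hulls -/

/-- The function symbols are genuine Skolem functions in `N`. In `N'` they need not be the chosen
ones, but the axiom saying that `F` finds witnesses for `φ` is a single sentence and passes along
`f`; the Tarski–Vaught test then applies. -/
theorem skolem_isElementary {N : Type (max u v)} [L.Structure N] [Nonempty N]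
    {N' : Type (max u v)} [(L.sum L.skolem₁).Structure N'] [L.Structure N']
    [(FirstOrder.Language.LHom.sumInl : L →ᴸ L.sum L.skolem₁).IsExpansionOn N']
    (f : N ↪ₑ[L.sum L.skolem₁] N') (S : (L.sum L.skolem₁).Substructure N') :
    ((FirstOrder.Language.LHom.sumInl : L →ᴸ L.sum L.skolem₁).substructureReduct S).IsElementary := by
  let ι : L →ᴸ L.sum L.skolem₁ := FirstOrder.Language.LHom.sumInl
  apply (ι.substructureReduct S).isElementary_of_exists
  intro n φ x a h
  let F : (L.sum L.skolem₁).Functions n := FirstOrder.Language.LHom.sumInr.onFunction φ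
  let B₀ : L.Formula (Fin (n + 1)) := φ.toFormula.relabel (Sum.elim Empty.elim id)
  have hB₀ : ∀ {M : Type (max u v)} [L.Structure M] (y : Fin (n + 1) → M),
      B₀.Realize y ↔ φ.Realize default y := by
    intro M _ y
    rw [FirstOrder.Language.Formula.realize_relabel,
      FirstOrder.Language.BoundedFormula.realize_toFormula]
    congr! 1
  let B : (L.sum L.skolem₁).Formula (Fin (n + 1)) := ι.onFormula B₀
  let tf : Fin (n + 1) → (L.sum L.skolem₁).Term (Fin n) :=
    Fin.snoc (α := fun _ => (L.sum L.skolem₁).Term (Fin n)) FirstOrder.Language.Term.var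
      (FirstOrder.Language.Term.func F FirstOrder.Language.Term.var)
  have htf : ∀ {M : Type (max u v)} [(L.sum L.skolem₁).Structure M] (y : Fin n → M),
      (fun i => (tf i).realize y) =
        Fin.snoc (α := fun _ => M) y (FirstOrder.Language.Structure.funMap F y) := by
    intro M _ y
    funext i
    refine Fin.lastCases ?_ (fun i => ?_) i
    · simp [tf]
    · simp [tf]
  let C : (L.sum L.skolem₁).Formula (Fin (n + 1)) :=
    FirstOrder.Language.Formula.relabel Fin.castSucc
      (FirstOrder.Language.BoundedFormula.subst B tf : (L.sum L.skolem₁).Formula (Fin n))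
  have hC : ∀ {M : Type (max u v)} [(L.sum L.skolem₁).Structure M] (y : Fin (n + 1) → M),
      C.Realize y ↔ B.Realize (Fin.snoc (α := fun _ => M) (y ∘ Fin.castSucc)
        (FirstOrder.Language.Structure.funMap F (y ∘ Fin.castSucc))) := by
    intro M _ y
    rw [FirstOrder.Language.Formula.realize_relabel, FirstOrder.Language.Formula.Realize,
      FirstOrder.Language.BoundedFormula.realize_subst, htf]
    rfl
  let D : (L.sum L.skolem₁).Formula Empty :=
    FirstOrder.Language.Formula.iAlls (Fin (n + 1))
      (FirstOrder.Language.Formula.relabel Sum.inr (B.imp C))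
  have hD : ∀ {M : Type (max u v)} [(L.sum L.skolem₁).Structure M] (e : Empty → M),
      D.Realize e ↔ ∀ y : Fin (n + 1) → M, B.Realize y → C.Realize y := by
    intro M _ e
    rw [FirstOrder.Language.Formula.realize_iAlls]
    refine forall_congr' fun y => ?_
    rw [FirstOrder.Language.Formula.realize_relabel, FirstOrder.Language.Formula.realize_imp]
    rfl
  have h1 : D.Realize (Empty.elim : Empty → N) := by
    rw [hD]
    intro y hy
    rw [hC, ι.realize_onFormula, hB₀]
    rw [ι.realize_onFormula, hB₀, ← Fin.snoc_init_self y] at hy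
    exact Classical.epsilon_spec (p := fun a => FirstOrder.Language.BoundedFormula.Realize φ default
          (Fin.snoc (y ∘ Fin.castSucc) a : Fin (n + 1) → N)) ⟨_, hy⟩
  have h2 := (hD _).1 ((f.map_formula D _).2 h1) (Fin.snoc (α := fun _ => N') ((↑) ∘ x) a)
    ((ι.realize_onFormula B₀).2 ((hB₀ _).2 h))
  rw [hC, ι.realize_onFormula, hB₀] at h2
  have h3 : (Fin.snoc (α := fun _ => N') ((↑) ∘ x) a : Fin (n + 1) → N') ∘ Fin.castSucc =
      (↑) ∘ x := by
    funext i; simp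
  rw [h3] at h2
  exact ⟨⟨_, S.fun_mem F (Subtype.val ∘ x) (by exact fun i => (x i).2)⟩, h2⟩

/-- Indiscernibility in an expanded language passes to elements given by terms. -/
theorem Indisc.of_term {L' : FirstOrder.Language.{u', v'}} (ι : L →ᴸ L') {N : Type y}
    [L.Structure N] [L'.Structure N] [ι.IsExpansionOn N] {A : Type*} {P' : Type*} {g : A → N}
    {I : Type x} [LinearOrder I] {n : ℕ} {b : I → Fin n → N} (h : Indisc L' g b) {g' : P' → N}
    (hg : ∀ p', ∃ t : L'.Term A, t.realize g = g' p') : Indisc L g' b := by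
  choose t ht using hg
  intro r ψ s s' hs hs'
  let τ : P' ⊕ Fin r × Fin n → L'.Term (A ⊕ Fin r × Fin n) := Sum.elim
    (fun p => (t p).relabel Sum.inl) (fun q => FirstOrder.Language.Term.var (Sum.inr q))
  have key : ∀ d : Fin r × Fin n → N,
      FirstOrder.Language.Formula.Realize
        (FirstOrder.Language.BoundedFormula.subst (ι.onFormula ψ) τ :
          L'.Formula (A ⊕ Fin r × Fin n)) (Sum.elim g d) ↔ ψ.Realize (Sum.elim g' d) := by
    intro d
    rw [FirstOrder.Language.Formula.Realize, FirstOrder.Language.BoundedFormula.realize_subst,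
      ← FirstOrder.Language.Formula.Realize, ι.realize_onFormula]
    congr! 1
    funext a
    rcases a with p | q
    · simp [τ, ht, FirstOrder.Language.Term.realize_relabel]
    · simp [τ]
  rw [← key, ← key]
  exact h r _ s s' hs hs'

/-! ### From systems to chains of models -/

/-- Ordinal division by R + 1 identifies a sequence of length `lam` with `lam` many blocks. Block α
occupies the positions (R + 1)·α + q, which are at least α, so the tail from α contains it. -/
theorem exists_block_map {lam : Cardinal.{w}} (hlam : ℵ₀ ≤ lam) (R : ℕ) :
    ∃ bm : Set.Iio lam.ord → Set.Iio lam.ord ×ₗ Fin (R + 1), StrictMono bm ∧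
      ∀ α, ∃ s : Fin (R + 1) → Set.Iio lam.ord, StrictMono s ∧ (∀ q, α ≤ s q) ∧
        ∀ q, bm (s q) = toLex (α, q) := by
  have hR : ((R + 1 : ℕ) : Ordinal.{w}) ≠ 0 := Nat.cast_ne_zero.2 (Nat.succ_ne_zero R)
  have hmod : ∀ β : Ordinal.{w}, ∃ q : Fin (R + 1), β % ((R + 1 : ℕ) : Ordinal.{w}) = (q : ℕ) := by
    intro β
    have h1 := Ordinal.mod_lt β hR
    obtain ⟨k, hk⟩ := Ordinal.lt_omega0.1 (h1.trans (Ordinal.natCast_lt_omega0 (R + 1)))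
    rw [hk, Nat.cast_lt] at h1
    exact ⟨⟨k, h1⟩, hk⟩
  choose md hmd using hmod
  have hnat : ∀ k : ℕ, (k : Ordinal.{w}) < lam.ord := fun k =>
    (Ordinal.natCast_lt_omega0 k).trans_le (Cardinal.omega0_le_ord.2 hlam)
  let bm : Set.Iio lam.ord → Set.Iio lam.ord ×ₗ Fin (R + 1) := fun β =>
    toLex (⟨β.1 / ((R + 1 : ℕ) : Ordinal.{w}), (Ordinal.div_le_of_le_mul (Ordinal.le_mul_right _ (pos_iff_ne_zero.2 hR))).trans_lt β.2⟩, md β.1)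
  refine ⟨bm, fun β γ hβγ => ?_, fun α => ?_⟩
  · rw [Prod.Lex.lt_iff]
    have h1 : β.1 / ((R + 1 : ℕ) : Ordinal.{w}) ≤ γ.1 / ((R + 1 : ℕ) : Ordinal.{w}) :=
      Ordinal.div_le_left (le_of_lt hβγ) _
    rcases h1.lt_or_eq with h | h
    · exact Or.inl h
    · refine Or.inr ⟨Subtype.ext h, ?_⟩
      have h2 : β.1 < γ.1 := hβγ
      rw [← Ordinal.div_add_mod β.1 ((R + 1 : ℕ) : Ordinal.{w}),
        ← Ordinal.div_add_mod γ.1 ((R + 1 : ℕ) : Ordinal.{w}), h, hmd, hmd] at h2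
      have h3 := (add_lt_add_iff_left _).1 h2
      exact_mod_cast h3
  · have hlt : ∀ q : Fin (R + 1),
        ((R + 1 : ℕ) : Ordinal.{w}) * α.1 + ((q : ℕ) : Ordinal.{w}) < lam.ord := fun q =>
      Ordinal.isPrincipal_add_ord hlam (Ordinal.isPrincipal_mul_ord hlam (hnat _) α.2) (hnat _)
    refine ⟨fun q => ⟨_, hlt q⟩, fun p q hpq => ?_, fun q => ?_, fun q => ?_⟩
    · refine Subtype.coe_lt_coe.1 ((add_lt_add_iff_left _).2 ?_)
      exact_mod_cast hpq
    · refine Subtype.coe_le_coe.1 ((?_ : α.1 ≤ _).trans le_self_add)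
      exact Ordinal.le_mul_right _ (pos_iff_ne_zero.2 hR)
    · have hq : ((q : ℕ) : Ordinal.{w}) < ((R + 1 : ℕ) : Ordinal.{w}) := Nat.cast_lt.2 q.2
      have h1 : (((R + 1 : ℕ) : Ordinal.{w}) * α.1 + ((q : ℕ) : Ordinal.{w})) /
          ((R + 1 : ℕ) : Ordinal.{w}) = α.1 := by
        rw [Ordinal.mul_add_div _ hR, Ordinal.div_eq_zero_of_lt hq, add_zero]
      have h2 : md (((R + 1 : ℕ) : Ordinal.{w}) * α.1 + ((q : ℕ) : Ordinal.{w})) = q := by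
        have := hmd (((R + 1 : ℕ) : Ordinal.{w}) * α.1 + ((q : ℕ) : Ordinal.{w}))
        rw [Ordinal.mul_add_mod_self, Ordinal.mod_eq_of_lt hq, Nat.cast_inj] at this
        exact (Fin.ext this).symm
      exact congrArg toLex (Prod.ext (Subtype.ext h1) h2)

/-- A tail indiscernible over a realization `d` of φ_i would contain a whole block indiscernible
over `d`; but φ_i makes the alternating Ψ_i true of `d` and that block, also in elementary
extensions. -/
theorem IsSystem.isShredWitness {m : ℕ} {I : Type w} [LinearOrder I] {P : I → Pattern L m}
    {J : I → Type x} [∀ i, LinearOrder (J i)] {N : Type (max u v)} [L.Structure N]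
    {z : Gen P J → N} {c : Fin m → N} (h : IsSystem P J z c) (i : I) {A : Set N}
    (hA : Indisc L (Subtype.val : A → N) (fun p l => z ⟨i, Sum.inr (p, l)⟩))
    {lam : Cardinal.{max u v}} {e : Set.Iio lam.ord → J i} (he : StrictMono e)
    {bm : Set.Iio lam.ord → Set.Iio lam.ord ×ₗ Fin ((P i).R + 1)} (hbm : StrictMono bm)
    (hs : ∀ α, ∃ s : Fin ((P i).R + 1) → Set.Iio lam.ord, StrictMono s ∧ (∀ q, α ≤ s q) ∧
        ∀ q, bm (s q) = toLex (α, q)) :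
    IsShredWitness lam A (P i).φ (fun l => z ⟨i, Sum.inl l⟩)
      (fun β l => z ⟨i, Sum.inr (toLex (e (ofLex (bm β)).1, (ofLex (bm β)).2), l)⟩) where
  indiscernible := indiscernibleOver_iff.2 (hA.comp_strictMono ((lex_map_strictMono he).comp hbm))
  not_tail_indiscernible := by
    intro N' _ f α d hd hind
    rw [indiscernibleOver_iff] at hind
    obtain ⟨s, hs, hle, hbs⟩ := hs α
    have h1 := hind.comp_strictMono (f := fun q => (⟨s q, hle q⟩ : Set.Ici α))
      (fun p q hpq => hs hpq)
    have h2 : Indisc L d _ := h1.of_range (g' := d) fun l => ⟨⟨d l, Or.inr ⟨l, rfl⟩⟩, rfl⟩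
    refine (P i).alternating N' d _ h2 ?_
    have h3 := (h.map f).imp i (e α) d hd
    convert h3 using 2
    funext q
    simp only [hbs, Function.comp_apply, ofLex_toLex]

theorem mem_restrict_typeOf_iff {N : Type (max u v)} [L.Structure N] [Nonempty N] {A B : Set N}
    (h : A ⊆ B) {m : ℕ} (c : Fin m → N) (ψ : L[[A]].Formula (Fin m)) :
    ψ ∈ restrict h ((L[[B]].completeTheory N).typeOf c) ↔ ψ.Realize c := by
  have := FirstOrder.Language.map_constants_inclusion_isExpansionOn L h
  rw [restrict, Set.mem_ofPred_eq, FirstOrder.Language.Theory.CompleteType.formula_mem_typeOf]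
  exact (L.lhomWithConstantsMap (Set.inclusion h)).realize_onFormula ψ

/-- The formula `φ(x; a)` as a formula over a set containing `a`. -/
def overParams {N : Type (max u v)} {B : Set N} {m k : ℕ}
    (φ : L.Formula (Fin m ⊕ Fin k)) (a : Fin k → B) : L[[B]].Formula (Fin m) :=
  FirstOrder.Language.BoundedFormula.constantsVarsEquiv.symm
    (φ.relabel (Sum.elim Sum.inr (fun l => Sum.inl (a l))) : L.Formula (B ⊕ Fin m))

theorem realize_constantsVarsEquiv_overParams {N : Type (max u v)} {B : Set N} {m k : ℕ}
    (φ : L.Formula (Fin m ⊕ Fin k)) (a : Fin k → B) {N' : Type (max u v)} [L.Structure N']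
    (f : B → N') (c : Fin m → N') :
    FirstOrder.Language.Formula.Realize (FirstOrder.Language.BoundedFormula.constantsVarsEquiv
      (overParams φ a) : L.Formula (B ⊕ Fin m)) (Sum.elim f c) ↔
      φ.Realize (Sum.elim c (fun l => f (a l))) := by
  rw [overParams, Equiv.apply_symm_apply, FirstOrder.Language.Formula.realize_relabel,
    Sum.comp_elim]
  rfl

theorem realize_overParams {N : Type (max u v)} [L.Structure N] {B : Set N} {m k : ℕ}
    (φ : L.Formula (Fin m ⊕ Fin k)) (a : Fin k → B) (c : Fin m → N) :
    (overParams φ a).Realize c ↔ φ.Realize (Sum.elim c (fun l => (a l : N))) :=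
  Iff.trans FirstOrder.Language.BoundedFormula.realize_constantsVarsEquiv.symm
    (realize_constantsVarsEquiv_overParams φ a (Subtype.val : B → N) c)

theorem implies_of_mem {N : Type (max u v)} [L.Structure N] {B : Set N} {m k : ℕ}
    {π : Set (L[[B]].Formula (Fin m))} {φ : L.Formula (Fin m ⊕ Fin k)} {a : Fin k → B}
    (h : overParams φ a ∈ π) : Implies π φ (fun l => (a l : N)) := by
  intro N' _ f c hc
  exact (realize_constantsVarsEquiv_overParams φ a (fun d : B => f d) c).1 (hc _ h)

/-- The models are the Skolem hulls of the names below o, and the type is that of `c`.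
Indiscernibility in the Skolem language over the earlier names extends to their hull, because the
hull consists of values of terms. -/
theorem hasShreddingChain_of_hasSystem {T : L.Theory} {m : ℕ} {κ : Cardinal.{max u v}}
    (h : HasSystem T m κ) : HasShreddingChain T m κ := by
  obtain ⟨N₀, _, P, z₀, c₀, _, hT₀, hsys₀⟩ := h
  obtain ⟨ν, hν⟩ := Cardinal.mem_range_aleph_iff.2
    (le_add_self : ℵ₀ ≤ (κ + L.card) + ℵ₀)
  have hκν : κ ≤ ℵ_ ν := by rw [hν]; exact le_self_add.trans le_self_add
  have hLν : L.card ≤ ℵ_ ν := by rw [hν]; exact le_add_self.trans le_self_add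
  obtain ⟨N, _, f₀, z, hsys⟩ := hsys₀.stretch (LenIdx ν)
  have : Nonempty N := ‹Nonempty N₀›.map f₀
  have hTN : N ⊨ T := (f₀.theory_model_iff T).1 hT₀
  let ι : L →ᴸ L.sum L.skolem₁ := FirstOrder.Language.LHom.sumInl
  obtain ⟨N', _, f, y, hy⟩ := exists_expansion.{u, v, max u v, v} ι hsys
  have : Nonempty N' := ‹Nonempty N›.map f
  let _ : L.Structure N' := ι.reduct N'
  have _ : ι.IsExpansionOn N' := ι.isExpansionOn_reduct N'
  have hreal : ∀ ψ : L.Formula (Gen P (LenIdx ν) ⊕ Fin m), ψ.Realize (Sum.elim z (f₀ ∘ c₀)) →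
      ψ.Realize y := fun ψ hψ => (ι.realize_onFormula ψ).1 (hy.realize ψ hψ)
  have hT' : N' ⊨ T := by
    refine ⟨fun φ hφ => ?_⟩
    have h1 := hreal (FirstOrder.Language.Formula.relabel Empty.elim φ)
    rw [FirstOrder.Language.Formula.realize_relabel,
      FirstOrder.Language.Formula.realize_relabel] at h1
    have h2 : N ⊨ φ := T.realize_sentence_of_mem hφ
    have h3 := h1 (by
      rw [Subsingleton.elim (_ ∘ _) (default : Empty → N)]; exact h2)
    rw [Subsingleton.elim (_ ∘ _) (default : Empty → N')] at h3
    exact h3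
  let c : Fin m → N' := y ∘ Sum.inr
  have hsys' : IsSystem P (LenIdx ν) (y ∘ Sum.inl) c := hsys.of_realize fun ψ hψ => by
    rw [Sum.elim_comp_inl_inr]
    exact hreal ψ hψ
  let X : Ordinal.{max u v} → Set N' := fun o =>
    (fun g : {g : Gen P (LenIdx ν) // pos g.1 < o} => y (Sum.inl g.1)) '' Set.univ
  have hX : Monotone X := by
    rintro o o' ho _ ⟨g, -, rfl⟩
    exact ⟨⟨g.1, g.2.trans_le ho⟩, trivial, rfl⟩
  let H : Ordinal.{max u v} → (L.sum L.skolem₁).Substructure N' := fun o =>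
    FirstOrder.Language.Substructure.closure _ (X o)
  have hH : Monotone H := fun o o' ho => FirstOrder.Language.Substructure.closure_mono (hX ho)
  let M : Ordinal.{max u v} → L.ElementarySubstructure N' := fun o =>
    ⟨ι.substructureReduct (H o), skolem_isElementary f (H o)⟩
  have hMmem : ∀ o x, x ∈ (M o : Set N') ↔ x ∈ H o := fun o x => Iff.rfl
  have hcard : ∀ i : κ.ord.ToType, #(M (pos i) : Set N') ≤ ℵ_ (ν + pos i) := by
    intro i
    have h0 : ℵ₀ ≤ ℵ_ (ν + pos i) := Cardinal.aleph0_le_aleph _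
    have h1 := FirstOrder.Language.Substructure.lift_card_closure_le
      (L := L.sum L.skolem₁) (s := X (pos i))
    rw [Cardinal.lift_id, Cardinal.lift_id, Cardinal.lift_id] at h1
    refine le_trans h1 (max_le h0 (Cardinal.add_le_of_le h0 ?_ ?_))
    · exact Cardinal.mk_image_le.trans (Cardinal.mk_univ.le.trans (mk_gen_lt_le hκν P _))
    · refine FirstOrder.Language.card_functions_sum_skolem₁_le.trans (max_le h0 (hLν.trans ?_))
      exact Cardinal.aleph_le_aleph.2 le_self_add
  have hgen : ∀ (g : Gen P (LenIdx ν)) (o : Ordinal.{max u v}), pos g.1 < o →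
      y (Sum.inl g) ∈ (M o : Set N') := fun g o hg =>
    FirstOrder.Language.Substructure.subset_closure ⟨⟨g, hg⟩, trivial, rfl⟩
  refine ⟨FirstOrder.Language.Theory.ModelType.of T N', M,
    (L[[(M κ.ord : Set N')]].completeTheory N').typeOf c, ?_, ?_, ?_⟩
  · intro i j hij _
    exact hH hij
  · intro δ hδ _
    refine Set.Subset.antisymm (fun x hx => ?_) (Set.iUnion₂_subset fun i hi => hH (le_of_lt hi))
    -- Continuity: a name below a limit is below some smaller ordinal, and the closure of an
    -- increasing union is the union of the closures.
    have hx' : x ∈ ⨆ i : Set.Iio δ, H i.1 := by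
      have hsub : X δ ⊆ ⋃ i : Set.Iio δ, X i.1 := by
        rintro _ ⟨g, -, rfl⟩
        exact Set.mem_iUnion.2 ⟨⟨Order.succ (pos g.1.1), hδ.succ_lt g.2⟩, ⟨g.1, Order.lt_succ _⟩,
          trivial, rfl⟩
      have := FirstOrder.Language.Substructure.closure_mono
        (L := L.sum L.skolem₁) hsub hx
      rwa [FirstOrder.Language.Substructure.closure_iUnion] at this
    have hne : Nonempty (Set.Iio δ) := ⟨⟨0, hδ.bot_lt⟩⟩
    have hdir : Directed (· ≤ ·) (fun i : Set.Iio δ => H i.1) :=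
      Monotone.directed_le fun i j hij => hH hij
    obtain ⟨i, hi⟩ := (FirstOrder.Language.Substructure.mem_iSup_of_directed hdir).1 hx'
    exact Set.mem_iUnion₂.2 ⟨i.1, i.2, hi⟩
  · intro o ho
    have hlim : Order.succ o ≤ κ.ord := Order.succ_le_of_lt ho
    refine ⟨hH hlim, hH (Order.le_succ o), ?_⟩
    let i : κ.ord.ToType := Ordinal.ToType.mk ⟨o, ho⟩
    have hpi : pos i = o := pos_mk _
    have hind : Indisc L (Subtype.val : ↥(M o : Set N') → N')
        (fun p l => (y ∘ Sum.inl) ⟨i, Sum.inr (p, l)⟩) := by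
      have h1 : Indisc (L.sum L.skolem₁) (Subtype.val : X o → N')
          (fun p l => (y ∘ Sum.inl) ⟨i, Sum.inr (p, l)⟩) := by
        refine (hy.indisc i trivial).of_range ?_
        rintro ⟨_, g, -, rfl⟩
        exact ⟨⟨g.1, pos_lt_pos.1 (g.2.trans_eq hpi.symm)⟩, rfl⟩
      exact h1.of_term ι fun x =>
        FirstOrder.Language.Substructure.mem_closure_iff_exists_term.1 x.2
    -- The hull has at most ℵ_(ν+o) elements, so the stretched sequence is at least as long as the
    -- default length; an initial segment of its blocks is used.
    have hlen : (defaultLength L (M o : Set N')).ord ≤ (len ν i).ord := by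
      rw [Cardinal.ord_le_ord, defaultLength, len]
      refine Order.succ_le_succ ?_
      have h0 : ℵ₀ ≤ ℵ_ (ν + pos i) := Cardinal.aleph0_le_aleph _
      refine Cardinal.add_le_of_le h0 (Cardinal.add_le_of_le h0
        (hLν.trans (Cardinal.aleph_le_aleph.2 le_self_add)) h0) ?_
      have := hcard i
      rwa [hpi] at this ⊢
    have hinf : ℵ₀ ≤ defaultLength L (M o : Set N') :=
      (le_add_self.trans le_self_add).trans (Order.le_succ _)
    obtain ⟨bm, hbm, hs⟩ := exists_block_map hinf (P i).R
    let e : Set.Iio (defaultLength L (M o : Set N')).ord → LenIdx ν i := fun β =>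
      Ordinal.ToType.mk ⟨β.1, β.2.trans_le hlen⟩
    have he : StrictMono e := fun β γ hβγ => Ordinal.ToType.mk.strictMono hβγ
    have hpos : pos i < Order.succ o := by rw [hpi]; exact Order.lt_succ o
    refine ⟨(P i).k, (P i).φ, _, (P i).n, _, ?_, hsys'.isShredWitness i hind he hbm hs, ?_⟩
    · refine implies_of_mem (a := fun l => ⟨y (Sum.inl ⟨i, Sum.inl l⟩), hgen _ _ hpos⟩) ?_
      exact (mem_restrict_typeOf_iff (N := N') (hH hlim) c _).2
        ((realize_overParams _ _ c).2 (hsys'.sat i))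
    · intro α l
      exact hgen _ _ hpos

/-! ### Extracting alternating formulas from failures of indiscernibility -/

/-- One instance of indiscernibility, over the parameters `e` and the variables selected by `ρ`,
of the sequence named by `β`. -/
def indInstance {m m' k r n : ℕ} (ρ : Fin m → Fin m') {P : Type w} {K : Type x}
    (β : K → Fin n → P) (ψ : L.Formula ((Fin k ⊕ Fin m) ⊕ Fin r × Fin n)) (e : Fin k → P)
    (s t : Fin r → K) : L.Formula (P ⊕ Fin m') :=
  (ψ.relabel (Sum.elim (Sum.elim (fun i => Sum.inl (e i)) (fun i => Sum.inr (ρ i)))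
    (fun q => Sum.inl (β (s q.1) q.2)))).imp
  (ψ.relabel (Sum.elim (Sum.elim (fun i => Sum.inl (e i)) (fun i => Sum.inr (ρ i)))
    (fun q => Sum.inl (β (t q.1) q.2))))

theorem realize_indInstance {m m' k r n : ℕ} (ρ : Fin m → Fin m') {P : Type w} {K : Type x}
    (β : K → Fin n → P) (ψ : L.Formula ((Fin k ⊕ Fin m) ⊕ Fin r × Fin n)) (e : Fin k → P)
    (s t : Fin r → K) {N : Type y} [L.Structure N] (g : P → N) (d : Fin m' → N) :
    (indInstance ρ β ψ e s t).Realize (Sum.elim g d) ↔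
      (ψ.Realize (Sum.elim (Sum.elim (g ∘ e) (d ∘ ρ)) (fun q => g (β (s q.1) q.2))) →
        ψ.Realize (Sum.elim (Sum.elim (g ∘ e) (d ∘ ρ)) (fun q => g (β (t q.1) q.2)))) := by
  simp only [indInstance, FirstOrder.Language.Formula.realize_imp,
    FirstOrder.Language.Formula.realize_relabel, Sum.comp_elim]
  exact Iff.rfl

/-- The formulas saying that the tail from `α` of the sequence named by `β` is indiscernible over
`A` and the variables selected by `ρ`. -/
def tailIndisc {m m' n : ℕ} (ρ : Fin m → Fin m') {P : Type w} {K : Type x} [LinearOrder K]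
    (A : Set P) (β : K → Fin n → P) (α : K) : Set (L.Formula (P ⊕ Fin m')) :=
  {χ | ∃ (k r : ℕ) (ψ : L.Formula ((Fin k ⊕ Fin m) ⊕ Fin r × Fin n)) (e : Fin k → P)
    (s t : Fin r → K), (∀ i, e i ∈ A) ∧ StrictMono s ∧ StrictMono t ∧ (∀ q, α ≤ s q) ∧
      (∀ q, α ≤ t q) ∧ χ = indInstance ρ β ψ e s t}

/-- Members of `tailIndisc` carry only finitely many parameters; this loses nothing, since no
formula uses more. -/
theorem tailIndisc_iff {m m' n : ℕ} {ρ : Fin m → Fin m'} {P : Type w} {K : Type x} [LinearOrder K]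
    {A : Set P} {β : K → Fin n → P} {α : K} {N : Type y} [L.Structure N] {g : P → N}
    {d : Fin m' → N} :
    (∀ χ ∈ tailIndisc (L := L) ρ A β α, χ.Realize (Sum.elim g d)) ↔
      Indisc L (Sum.elim (fun p : A => g p) (d ∘ ρ)) (fun (k : Set.Ici α) l => g (β k l)) := by
  constructor
  · intro h
    have h1 : ∀ (k : ℕ) (e : Fin k → A),
        Indisc L (Sum.elim ((fun p : A => g p) ∘ e) (d ∘ ρ))
          (fun (k : Set.Ici α) l => g (β k l)) := by
      intro k e r ψ s t hs ht
      exact (realize_indInstance ρ β ψ (fun i => (e i : P)) (fun q => (s q : K))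
        (fun q => (t q : K)) g d).1 (h _ ⟨k, r, ψ, _, _, _, fun i => (e i).2, fun _ _ h => hs h,
          fun _ _ h => ht h, fun q => (s q).2, fun q => (t q).2, rfl⟩)
    intro r ψ s t hs ht
    obtain ⟨k, e, ψ', -, H⟩ := exists_finite_parameters.{u, v, w, 0, y}
      (Q := Fin m ⊕ Fin r × Fin n) (ψ.relabel (Equiv.sumAssoc _ _ _))
    have H' : ∀ z : Fin r × Fin n → N,
        (ψ'.relabel (Equiv.sumAssoc (Fin k) (Fin m) (Fin r × Fin n)).symm).Realize
          (Sum.elim (Sum.elim ((fun p : A => g p) ∘ e) (d ∘ ρ)) z) ↔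
        ψ.Realize (Sum.elim (Sum.elim (fun p : A => g p) (d ∘ ρ)) z) := by
      intro z
      rw [FirstOrder.Language.Formula.realize_relabel]
      have h2 := H N (fun p : A => g p) (Sum.elim (d ∘ ρ) z)
      rw [FirstOrder.Language.Formula.realize_relabel] at h2
      convert h2 using 2
      · funext a; rcases a with a | a | a <;> rfl
      · funext a; rcases a with (a | a) | a <;> rfl
    rw [← H', ← H']
    exact h1 k e r _ s t hs ht
  · rintro h _ ⟨k, r, ψ, e, s, t, he, hs, ht, hsα, htα, rfl⟩
    rw [realize_indInstance]
    have h1 : Indisc L (Sum.elim (g ∘ e) (d ∘ ρ)) (fun (k : Set.Ici α) l => g (β k l)) :=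
      h.of_range (by
        rintro (i | i)
        · exact ⟨Sum.inl ⟨e i, he i⟩, rfl⟩
        · exact ⟨Sum.inr i, rfl⟩)
    exact h1 r ψ (fun q => ⟨s q, hsα q⟩) (fun q => ⟨t q, htα q⟩) (fun _ _ h => hs h)
      (fun _ _ h => ht h)

/-- The data extracted from a failure of indiscernibility, without positions in the sequence. -/
structure Datum {P : Type w} (A : Set P) (m n : ℕ) {m' : ℕ} (S : Set (L.Formula (P ⊕ Fin m'))) where
  /-- The finitely many formulas responsible for the failure. -/
  G : Finset S
  /-- The number of parameters. -/
  k : ℕ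
  /-- One less than the number of terms of the sequence. -/
  R : ℕ
  /-- The parameters. -/
  e : Fin k → A
  /-- The alternating formula. -/
  Θ : L.Formula (Fin m ⊕ (Fin k ⊕ Fin (R + 1) × Fin n))

/-- The datum `D` describes a failure of indiscernibility above `α`. -/
structure Datum.IsGood {N : Type (max u v)} [L.Structure N] {P : Type w} {A : Set P} {m n m' : ℕ}
    {S : Set (L.Formula (P ⊕ Fin m'))} (D : Datum A m n S) (ρ : Fin m → Fin m') (g : P → N)
    {K : Type x} [LinearOrder K] (β : K → Fin n → P) (α : K) : Prop where
  alternating : ∀ (N : Type (max u v)) [L.Structure N] (c : Fin m → N) (e : Fin D.k → N)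
      (b : Fin (D.R + 1) → Fin n → N), Indisc L (Sum.elim c e) b →
      ¬ D.Θ.Realize (Sum.elim c (Sum.elim e fun q => b q.1 q.2))
  imp : ∃ p : Fin (D.R + 1) → K, StrictMono p ∧ (∀ q, α ≤ p q) ∧ ∀ d : Fin m' → N,
    (∀ ψ ∈ D.G, ψ.1.Realize (Sum.elim g d)) →
    D.Θ.Realize (Sum.elim (d ∘ ρ) (Sum.elim (fun i => g (D.e i)) fun q => g (β (p q.1) q.2)))

/-- An unsatisfiable finite subset splits into members `G` of `S` and instances of indiscernibility.
`Θ` is the negated conjunction of these instances, written in the R + 1 positions that occur: it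
follows from `G`, and indiscernibility refutes it. -/
theorem exists_datum {N : Type (max u v)} [L.Structure N] {P : Type w} {A : Set P} {m n m' : ℕ}
    {S : Set (L.Formula (P ⊕ Fin m'))} (ρ : Fin m → Fin m') (g : P → N)
    {K : Type x} [LinearOrder K] (β : K → Fin n → P) (α : K)
    (h : ¬ FinSat g (S ∪ tailIndisc ρ A β α)) :
    ∃ D : Datum A m n S, D.IsGood ρ g β α := by
  classical
  simp only [FinSat, not_forall, not_exists] at h
  obtain ⟨F, hF, hunsat⟩ := h
  let H := {χ : L.Formula (P ⊕ Fin m') // χ ∈ F.filter (· ∉ S)}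
  have hH : ∀ χ : H, χ.1 ∈ tailIndisc ρ A β α := fun χ =>
    (hF (Finset.mem_filter.1 χ.2).1).resolve_left (Finset.mem_filter.1 χ.2).2
  choose k r ψ e s t he hs ht hsα htα hχ using hH
  let E : Finset A := Finset.univ.biUnion fun χ : H => Finset.univ.image fun i =>
    (⟨e χ i, he χ i⟩ : A)
  -- Including `α` makes the set of positions nonempty, so that its size has the form R + 1.
  let D : Finset K := insert α ((Finset.univ.biUnion fun χ : H => Finset.univ.image (s χ)) ∪
    (Finset.univ.biUnion fun χ : H => Finset.univ.image (t χ)))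
  have hDα : ∀ a ∈ D, α ≤ a := by
    intro a ha
    simp only [D, Finset.mem_insert, Finset.mem_union, Finset.mem_biUnion, Finset.mem_univ,
      Finset.mem_image, true_and] at ha
    rcases ha with rfl | ⟨χ, q, rfl⟩ | ⟨χ, q, rfl⟩
    exacts [le_rfl, hsα χ q, htα χ q]
  have hsD : ∀ χ q, s χ q ∈ D := fun χ q => by
    simp only [D, Finset.mem_insert, Finset.mem_union, Finset.mem_biUnion, Finset.mem_univ,
      Finset.mem_image, true_and]
    exact Or.inr (Or.inl ⟨χ, q, rfl⟩)
  have htD : ∀ χ q, t χ q ∈ D := fun χ q => by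
    simp only [D, Finset.mem_insert, Finset.mem_union, Finset.mem_biUnion, Finset.mem_univ,
      Finset.mem_image, true_and]
    exact Or.inr (Or.inr ⟨χ, q, rfl⟩)
  have heE : ∀ χ i, (⟨e χ i, he χ i⟩ : A) ∈ E := fun χ i => by
    simp only [E, Finset.mem_biUnion, Finset.mem_univ, Finset.mem_image, true_and]
    exact ⟨χ, i, rfl⟩
  obtain ⟨R, hR⟩ : ∃ R, D.card = R + 1 :=
    Nat.exists_eq_succ_of_ne_zero (Finset.card_ne_zero_of_mem (Finset.mem_insert_self α _))
  let o := D.orderIsoOfFin hR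
  let σ : ∀ χ : H, Fin (r χ) → Fin (R + 1) := fun χ q => o.symm ⟨s χ q, hsD χ q⟩
  let σ' : ∀ χ : H, Fin (r χ) → Fin (R + 1) := fun χ q => o.symm ⟨t χ q, htD χ q⟩
  have hσ : ∀ χ, StrictMono (σ χ) := fun χ a b hab => o.symm.strictMono (hs χ hab)
  have hσ' : ∀ χ, StrictMono (σ' χ) := fun χ a b hab => o.symm.strictMono (ht χ hab)
  let τ : ∀ χ : H, Fin (k χ) → Fin E.card := fun χ i => E.equivFin ⟨_, heE χ i⟩
  let ν : ∀ χ : H, (Fin (r χ) → Fin (R + 1)) → (Fin (k χ) ⊕ Fin m) ⊕ Fin (r χ) × Fin n →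
      Fin m ⊕ (Fin E.card ⊕ Fin (R + 1) × Fin n) := fun χ σ =>
    Sum.elim (Sum.elim (fun i => Sum.inr (Sum.inl (τ χ i))) Sum.inl)
      (fun q => Sum.inr (Sum.inr (σ q.1, q.2)))
  let Θ : L.Formula (Fin m ⊕ (Fin E.card ⊕ Fin (R + 1) × Fin n)) :=
    ∼(FirstOrder.Language.Formula.iInf fun χ : H =>
      ((ψ χ).relabel (ν χ (σ χ))).imp ((ψ χ).relabel (ν χ (σ' χ))))
  have hΘ : ∀ (M : Type (max u v)) [L.Structure M] (c : Fin m → M) (a : Fin E.card → M)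
      (b : Fin (R + 1) → Fin n → M),
      Θ.Realize (Sum.elim c (Sum.elim a fun q => b q.1 q.2)) ↔ ¬ ∀ χ : H,
        (ψ χ).Realize (Sum.elim (Sum.elim (a ∘ τ χ) c) fun q => b (σ χ q.1) q.2) →
        (ψ χ).Realize (Sum.elim (Sum.elim (a ∘ τ χ) c) fun q => b (σ' χ q.1) q.2) := by
    intro M _ c a b
    simp only [Θ, FirstOrder.Language.Formula.realize_not,
      FirstOrder.Language.Formula.realize_iInf, FirstOrder.Language.Formula.realize_imp,
      FirstOrder.Language.Formula.realize_relabel, ν, Sum.comp_elim]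
    exact Iff.rfl
  let en : Fin E.card → A := fun i => (E.equivFin.symm i).1
  have hen : ∀ χ i, (en (τ χ i) : P) = e χ i := fun χ i => by simp [en, τ]
  refine ⟨⟨F.subtype (· ∈ S), E.card, R, en, Θ⟩, ?_, fun q => (o q : K), fun a b hab => o.strictMono hab,
    fun q => hDα _ (o q).2, ?_⟩
  · intro M _ c a b hb hr
    refine (hΘ M c a b).1 hr fun χ => ?_
    have h1 : Indisc L (Sum.elim (a ∘ τ χ) c) b := hb.of_range (by
      rintro (i | i)
      · exact ⟨Sum.inr (τ χ i), rfl⟩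
      · exact ⟨Sum.inl i, rfl⟩)
    exact h1 _ (ψ χ) _ _ (hσ χ) (hσ' χ)
  · intro d hd
    refine (hΘ N _ _ (fun q l => g (β (o q) l))).2 fun hall => ?_
    obtain ⟨χ, hχF, hn⟩ := hunsat d
    refine hn ?_
    by_cases hχS : χ ∈ S
    · exact hd ⟨χ, hχS⟩ (Finset.mem_subtype.2 hχF)
    · let χ' : H := ⟨χ, Finset.mem_filter.2 ⟨hχF, hχS⟩⟩
      have h1 := hall χ'
      rw [show χ = indInstance ρ β (ψ χ') (e χ') (s χ') (t χ') from hχ χ', realize_indInstance]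
      have h2 : (fun i => g (en i)) ∘ τ χ' = g ∘ e χ' := by
        funext i; exact congrArg g (hen χ' i)
      simp only [σ, σ', OrderIso.apply_symm_apply, h2] at h1
      exact h1

/-! ### Counting data and choosing one for all tails -/

theorem mk_finset_le {X : Type w} {μ : Cardinal.{w}} (hμ : ℵ₀ ≤ μ) (hX : #X ≤ μ) :
    #(Finset X) ≤ μ := by
  refine (Cardinal.mk_le_of_injective (f := fun s : Finset X => s.toList) fun s t h => ?_).trans
    ((Cardinal.mk_list_le_max X).trans (max_le hμ hX))
  classical
  rw [← s.toList_toFinset, ← t.toList_toFinset]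
  exact congrArg List.toFinset h

theorem mk_formula_le {μ : Cardinal.{max u v}} (hμ : ℵ₀ ≤ μ) (hL : L.card ≤ μ) (X : Type)
    [Finite X] : #(L.Formula X) ≤ μ := by
  have h1 := FirstOrder.Language.BoundedFormula.card_le (L := L) (α := X)
  refine (Cardinal.mk_le_of_injective (f := fun φ : L.Formula X =>
    (⟨0, φ⟩ : Σ n, L.BoundedFormula X n)) fun φ ψ h => by simpa using h).trans (h1.trans ?_)
  refine max_le hμ (Cardinal.add_le_of_le hμ ?_ ?_)
  · exact (Cardinal.lift_lt_aleph0.2 (Cardinal.lt_aleph0_of_finite X)).le.trans hμ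
  · simpa using hL

theorem mk_sigma_nat_le {μ : Cardinal.{w}} (hμ : ℵ₀ ≤ μ) {f : ℕ → Type w} (hf : ∀ n, #(f n) ≤ μ) :
    #(Σ n, f n) ≤ μ := by
  rw [Cardinal.mk_sigma]
  refine (Cardinal.sum_le_sum _ (fun _ => μ) hf).trans ?_
  rw [Cardinal.sum_const, Cardinal.lift_uzero, Cardinal.mk_nat, Cardinal.lift_aleph0]
  exact Cardinal.mul_le_of_le hμ hμ le_rfl

theorem mk_datum_le {P : Type (max u v)} {A : Set P} {m n m' : ℕ}
    {S : Set (L.Formula (P ⊕ Fin m'))} {μ : Cardinal.{max u v}} (hμ : ℵ₀ ≤ μ)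
    (hL : L.card ≤ μ) (hA : #A ≤ μ) (hS : #S ≤ μ) : #(Datum A m n S) ≤ μ := by
  let f : Datum A m n S → Finset S × Σ k R : ℕ, (Fin k → A) ×
      L.Formula (Fin m ⊕ (Fin k ⊕ Fin (R + 1) × Fin n)) := fun D => (D.G, ⟨D.k, D.R, D.e, D.Θ⟩)
  have hf : Function.Injective f := by
    rintro ⟨G, k, R, e, Θ⟩ ⟨G', k', R', e', Θ'⟩ h
    simp only [f, Prod.mk.injEq, Sigma.mk.injEq] at h
    obtain ⟨rfl, rfl, h⟩ := h
    obtain ⟨rfl, h⟩ := by simpa using h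
    obtain ⟨rfl, rfl⟩ := by simpa using h
    rfl
  refine (Cardinal.mk_le_of_injective hf).trans ?_
  rw [Cardinal.mk_prod, Cardinal.lift_id, Cardinal.lift_id]
  refine Cardinal.mul_le_of_le hμ (mk_finset_le hμ hS) ?_
  refine mk_sigma_nat_le hμ fun k => mk_sigma_nat_le hμ fun R => ?_
  rw [Cardinal.mk_prod, Cardinal.lift_id, Cardinal.lift_id]
  refine Cardinal.mul_le_of_le hμ ?_ (mk_formula_le hμ hL _)
  have : #(Fin k → A) = #A ^ k := by simp
  rw [this]
  exact (Cardinal.power_le_power_right hA).trans (Cardinal.power_nat_le hμ)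

/-- There are at most μ data, and families of size μ are bounded in `K`, so some datum is good above
every α. Iterating it gives ω successive blocks, and its parameters are absorbed by appending them
to each term. -/
theorem exists_alternating_blocks {N : Type (max u v)} [L.Structure N]
    {P : Type (max u v)} {A : Set P} {m n m' : ℕ} {S : Set (L.Formula (P ⊕ Fin m'))}
    (ρ : Fin m → Fin m') (g : P → N) {K : Type x} [LinearOrder K] [NoMaxOrder K]
    [Nonempty K] {β : K → Fin n → P}
    (hind : Indisc L (fun p : A => g p) (fun k l => g (β k l)))
    {μ : Cardinal.{max u v}} (hμ : ℵ₀ ≤ μ) (hL : L.card ≤ μ) (hA : #A ≤ μ) (hS : #S ≤ μ)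
    (hK : ∀ (X : Type (max u v)) (f : X → K), #X ≤ μ → ∃ k, ∀ x, f x < k)
    (h : ∀ α, ¬ FinSat g (S ∪ tailIndisc ρ A β α)) :
    ∃ (G : Finset S) (R n' : ℕ) (Ψ : L.Formula (Fin m ⊕ Fin (R + 1) × Fin n'))
      (b : ℕ → Fin (R + 1) → Fin n' → P), IsAlternating Ψ ∧
      (∀ ξ q l, b ξ q l ∈ A ∨ ∃ k l', b ξ q l = β k l') ∧
      Indisc L (fun p : A => g p) (fun (p : ℕ ×ₗ Fin (R + 1)) l => g (b (ofLex p).1 (ofLex p).2 l)) ∧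
      ∀ ξ (d : Fin m' → N), (∀ ψ ∈ G, ψ.1.Realize (Sum.elim g d)) →
        Ψ.Realize (Sum.elim (d ∘ ρ) fun q => g (b ξ q.1 q.2)) := by
  have hD : ∃ D : Datum A m n S, ∀ α, D.IsGood ρ g β α := by
    -- Otherwise each datum fails at some point of `K`. A datum good above a common bound of these
    -- points is good at its own point of failure, since being good passes to smaller α.
    by_contra! hcon
    choose f hf using hcon
    obtain ⟨α, hα⟩ := hK (Datum A m n S) f (mk_datum_le hμ hL hA hS)
    obtain ⟨D, hD⟩ := exists_datum ρ g β α (h α)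
    obtain ⟨p, hp, hpα, himp⟩ := hD.imp
    exact hf D ⟨hD.alternating, p, hp, fun q => (hα D).le.trans (hpα q), himp⟩
  obtain ⟨D, hD⟩ := hD
  choose p hp hpα himp using fun α => (hD α).imp
  have hgt : ∀ k : K, ∃ k', k < k' := exists_gt
  choose nx hnx using hgt
  let α : ℕ → K := fun ξ => Nat.rec (Classical.arbitrary K) (fun _ a => nx (p a (Fin.last _))) ξ
  have hα : ∀ ξ q, p (α ξ) q < α (ξ + 1) := fun ξ q =>
    ((hp (α ξ)).monotone (Fin.le_last q)).trans_lt (hnx _)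
  have hαm : StrictMono α := strictMono_nat_of_lt_succ fun ξ => (hpα _ 0).trans_lt (hα ξ 0)
  have hpm : StrictMono (fun x : ℕ ×ₗ Fin (D.R + 1) => p (α (ofLex x).1) (ofLex x).2) := by
    intro x y hxy
    rw [Prod.Lex.lt_iff] at hxy
    rcases hxy with h1 | ⟨h1, h2⟩
    · exact (hα _ _).trans_le ((hαm.monotone (Nat.succ_le_of_lt h1)).trans (hpα _ _))
    · simp only [h1]
      exact hp _ h2
  obtain ⟨Ψ, hΨ, hΨΘ⟩ := exists_alternating_absorb D.Θ
    (hD (Classical.arbitrary K)).alternating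
  let b : ℕ → Fin (D.R + 1) → Fin (n + D.k) → P := fun ξ q =>
    Fin.append (β (p (α ξ) q)) (fun i => (D.e i : P))
  have hb : ∀ ξ q, (fun l => g (b ξ q l)) = Fin.append (fun l => g (β (p (α ξ) q) l))
      (fun i => g (D.e i)) := by
    intro ξ q
    funext l
    refine Fin.addCases (fun l => ?_) (fun l => ?_) l <;> simp [b]
  refine ⟨D.G, D.R, n + D.k, Ψ, b, hΨ, fun ξ q l => ?_, ?_, fun ξ d hd => ?_⟩
  · refine Fin.addCases (fun l => ?_) (fun l => ?_) l
    · exact Or.inr ⟨p (α ξ) q, l, by simp [b]⟩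
    · refine Or.inl ?_
      simp [b]
  · have h1 := (hind.comp_strictMono hpm).append (e := fun i => g (D.e i))
      (fun i => ⟨D.e i, rfl⟩)
    convert h1 using 2 with x
    exact hb _ _
  · have h1 := (hΨΘ N (d ∘ ρ) (fun i => g (D.e i)) (fun q l => g (β (p (α ξ) q) l))).2
      (himp (α ξ) d hd)
    convert h1 using 2
    funext q
    exact congrFun (hb ξ q.1) q.2

/-! ### From chains of models to systems -/

/-- Finitely many formulas amount to a single one with finitely many parameters. -/
theorem exists_formula_of_finset {P : Type w} {m m' : ℕ} (ρ : Fin m → Fin m')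
    (G : Finset (L.Formula (P ⊕ Fin m'))) :
    ∃ (k : ℕ) (e : Fin k → P) (φ : L.Formula (Fin m ⊕ Fin k)),
      ∀ (N : Type y) [L.Structure N] [Nonempty N] (g : P → N) (c : Fin m → N),
        φ.Realize (Sum.elim c (g ∘ e)) ↔
          ∃ d : Fin m' → N, d ∘ ρ = c ∧ ∀ ψ ∈ G, ψ.Realize (Sum.elim g d) := by
  let θ : L.Formula ((P ⊕ Fin m) ⊕ Fin m') :=
    FirstOrder.Language.Formula.iInf (fun ψ : G =>
      ψ.1.relabel (Sum.map Sum.inl id)) ⊓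
    FirstOrder.Language.Formula.iInf (fun i : Fin m =>
      (FirstOrder.Language.Term.var (Sum.inr (ρ i))).equal
        (FirstOrder.Language.Term.var (Sum.inl (Sum.inr i))))
  obtain ⟨θ', hθ'⟩ := exists_projection.{u, v, _, _, y} θ
  obtain ⟨k, e, φ, -, hφ⟩ := exists_finite_parameters.{u, v, _, _, y} θ'
  refine ⟨k, e, φ.relabel Sum.swap, fun N _ _ g c => ?_⟩
  have hsw : Sum.elim c (g ∘ e) ∘ Sum.swap = Sum.elim (g ∘ e) c := by
    funext a; rcases a with a | a <;> rfl
  rw [FirstOrder.Language.Formula.realize_relabel, hsw, hφ, hθ']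
  refine exists_congr fun d => ?_
  simp only [θ, FirstOrder.Language.Formula.realize_inf, FirstOrder.Language.Formula.realize_iInf,
    FirstOrder.Language.Formula.realize_relabel, FirstOrder.Language.Formula.realize_equal,
    FirstOrder.Language.Term.realize_var, Sum.elim_inl, Sum.elim_inr, Sum.elim_comp_map,
    Sum.elim_comp_inl, Function.comp_id, Subtype.forall]
  rw [and_comm, funext_iff]
  rfl

theorem forall_imp_of_elementary {N N' : Type*} [L.Structure N] [L.Structure N'] (f : N ↪ₑ[L] N')
    {m : ℕ} {α β : Type*} {φ : L.Formula (Fin m ⊕ α)} {ψ : L.Formula (Fin m ⊕ β)} {g : α → N}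
    {h : β → N} (H : ∀ d, φ.Realize (Sum.elim d g) → ψ.Realize (Sum.elim d h)) (d : Fin m → N')
    (hd : φ.Realize (Sum.elim d (f ∘ g))) : ψ.Realize (Sum.elim d (f ∘ h)) := by
  let θ : L.Formula (α ⊕ β) := ((φ.relabel (Sum.elim Sum.inr (fun a => Sum.inl (Sum.inl a)))).imp
    (ψ.relabel (Sum.elim Sum.inr (fun a => Sum.inl (Sum.inr a))))).iAlls (Fin m)
  have hθ : ∀ {M : Type _} [L.Structure M] (g : α → M) (h : β → M), θ.Realize (Sum.elim g h) ↔
      ∀ d, φ.Realize (Sum.elim d g) → ψ.Realize (Sum.elim d h) := by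
    intro M _ g h
    rw [FirstOrder.Language.Formula.realize_iAlls]
    refine forall_congr' fun d => ?_
    simp only [FirstOrder.Language.Formula.realize_imp,
      FirstOrder.Language.Formula.realize_relabel, Sum.comp_elim]
    exact Iff.rfl
  -- The same equivalence, now in the universe of `N'`.
  have hθ' : ∀ {M : Type _} [L.Structure M] (g : α → M) (h : β → M), θ.Realize (Sum.elim g h) ↔
      ∀ d, φ.Realize (Sum.elim d g) → ψ.Realize (Sum.elim d h) := by
    intro M _ g h
    rw [FirstOrder.Language.Formula.realize_iAlls]
    refine forall_congr' fun d => ?_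
    simp only [FirstOrder.Language.Formula.realize_imp,
      FirstOrder.Language.Formula.realize_relabel, Sum.comp_elim]
    exact Iff.rfl
  have h1 := (f.map_formula θ _).2 ((hθ g h).2 H)
  rw [Sum.comp_elim, hθ'] at h1
  exact h1 d hd

/-- A complete type is realized in some model of the theory of `N` over `B`, which need not extend
`N`. Existential sentences over `B` pass from that model to `N`, so the type is finitely satisfiable
in `N` and hence realized in an elementary extension. One realization serves all restrictions. -/
theorem exists_realizesType {N : Type (max u v)} [L.Structure N] [Nonempty N] {B : Set N} {m : ℕ}
    (p : TypesOver L B m) :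
    ∃ (N' : Type (max u v)) (_ : L.Structure N') (f : N ↪ₑ[L] N') (c : Fin m → N'),
      ∀ (A : Set N) (h : A ⊆ B), RealizesType (restrict h p) f c := by
  obtain ⟨M, v, hv⟩ := FirstOrder.Language.Theory.exists_modelType_is_realized_in _ p
  let _ : L.Structure M := (L.lhomWithConstants B).reduct M
  have _ : (L.lhomWithConstants B).IsExpansionOn M := (L.lhomWithConstants B).isExpansionOn_reduct M
  let S : Set (L.Formula (B ⊕ Fin m)) := {ψ | ψ.Realize (Sum.elim (fun a => (L.con a : M)) v)}
  have hS : FinSat (Subtype.val : B → N) S := by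
    intro F hF
    let χ : L[[B]].Formula (Fin m) := FirstOrder.Language.BoundedFormula.constantsVarsEquiv.symm
      (FirstOrder.Language.Formula.iInf (fun ψ : F => ψ.1) : L.Formula (B ⊕ Fin m))
    have hχ : FirstOrder.Language.BoundedFormula.constantsVarsEquiv χ =
      (FirstOrder.Language.Formula.iInf (fun ψ : F => ψ.1) : L.Formula (B ⊕ Fin m)) :=
      Equiv.apply_symm_apply _ _
    let σ : L[[B]].Sentence :=
      (χ.relabel Sum.inr : L[[B]].Formula (Empty ⊕ Fin m)).iExs (Fin m)
    have hσM : M ⊨ σ := by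
      refine FirstOrder.Language.Formula.realize_iExs.2 ⟨v, ?_⟩
      rw [FirstOrder.Language.Formula.realize_relabel, Sum.elim_comp_inr]
      refine FirstOrder.Language.BoundedFormula.realize_constantsVarsEquiv.1 ?_
      rw [hχ]
      exact FirstOrder.Language.Formula.realize_iInf.2 fun ψ => hF ψ.2
    have hσN : N ⊨ σ :=
      (FirstOrder.Language.realize_iff_of_model_completeTheory N M σ).1 hσM
    obtain ⟨z, hz⟩ := FirstOrder.Language.Formula.realize_iExs.1 hσN
    rw [FirstOrder.Language.Formula.realize_relabel, Sum.elim_comp_inr] at hz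
    have hz' := FirstOrder.Language.BoundedFormula.realize_constantsVarsEquiv.2 hz
    rw [hχ] at hz'
    exact ⟨z, fun ψ hψ => FirstOrder.Language.Formula.realize_iInf.1 hz' ⟨ψ, hψ⟩⟩
  obtain ⟨N', _, f, c, hc⟩ := exists_realization _ S hS
  refine ⟨N', inferInstance, f, c, fun A h ψ hψ => ?_⟩
  let ι := L.lhomWithConstantsMap (Set.inclusion h)
  have h1 := hc (FirstOrder.Language.Formula.relabel (Sum.map (Set.inclusion h) id)
    (FirstOrder.Language.BoundedFormula.constantsVarsEquiv ψ : L.Formula (A ⊕ Fin m))) ?_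
  · rw [FirstOrder.Language.Formula.realize_relabel, Sum.elim_comp_map] at h1
    exact h1
  · let _ : L[[A]].Structure M := ι.reduct M
    have _ : ι.IsExpansionOn M := ι.isExpansionOn_reduct M
    have _ : (L.lhomWithConstants A).IsExpansionOn M := ⟨fun _ _ => rfl, fun _ _ => rfl⟩
    have h2 : FirstOrder.Language.Formula.equivSentence (ι.onFormula ψ) ∈ p := hψ
    rw [← hv, FirstOrder.Language.Theory.CompleteType.formula_mem_typeOf,
      ι.realize_onFormula] at h2
    have h3 := FirstOrder.Language.BoundedFormula.realize_constantsVarsEquiv.2 h2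
    change FirstOrder.Language.Formula.Realize _ _
    rw [FirstOrder.Language.Formula.realize_relabel, Sum.elim_comp_map]
    exact h3

/-- A formula implied by a type is implied by a formula of the type. -/
theorem exists_formula_of_implies {N : Type (max u v)} [L.Structure N] [Nonempty N] {B : Set N}
    {m k : ℕ} {π : Set (L[[B]].Formula (Fin m))} {φ : L.Formula (Fin m ⊕ Fin k)} {a : Fin k → N}
    (h : Implies π φ a) {N' : Type (max u v)} [L.Structure N'] {f : N ↪ₑ[L] N'} {c : Fin m → N'}
    (hc : RealizesType π f c) :
    ∃ χ : L.Formula (B ⊕ Fin m), χ.Realize (Sum.elim (fun b : B => f b) c) ∧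
      ∀ d : Fin m → N, χ.Realize (Sum.elim (Subtype.val : B → N) d) →
        φ.Realize (Sum.elim d a) := by
  classical
  by_contra! hcon
  let nφ : L.Formula (N ⊕ Fin m) := ∼(φ.relabel (Sum.elim Sum.inr fun l => Sum.inl (a l)))
  let up : L.Formula (B ⊕ Fin m) → L.Formula (N ⊕ Fin m) := fun χ =>
    χ.relabel (Sum.map Subtype.val id)
  let S : Set (L.Formula (N ⊕ Fin m)) := insert nφ
    (up '' {χ | χ.Realize (Sum.elim (fun b : B => f b) c)})
  have hnφ : ∀ {M : Type (max u v)} [L.Structure M] (g : N → M) (d : Fin m → M),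
      nφ.Realize (Sum.elim g d) ↔ ¬ φ.Realize (Sum.elim d (g ∘ a)) := by
    intro M _ g d
    simp only [nφ, FirstOrder.Language.Formula.realize_not,
      FirstOrder.Language.Formula.realize_relabel, Sum.comp_elim]
    exact Iff.rfl
  have hup : ∀ {M : Type (max u v)} [L.Structure M] (g : N → M) (d : Fin m → M) χ,
      (up χ).Realize (Sum.elim g d) ↔ χ.Realize (Sum.elim (fun b : B => g b) d) := by
    intro M _ g d χ
    simp only [up, FirstOrder.Language.Formula.realize_relabel, Sum.elim_comp_map]
    exact Iff.rfl
  have hS : FinSat (id : N → N) S := by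
    intro F hF
    have hF' : ∀ χ ∈ F, χ ≠ nφ → ∃ χ', χ'.Realize (Sum.elim (fun b : B => f b) c) ∧ up χ' = χ :=
      fun χ hχ hne => (hF hχ).resolve_left hne
    choose! u hu1 hu2 using hF'
    let F' := F.filter (· ≠ nφ)
    obtain ⟨d, hd1, hd2⟩ := hcon (FirstOrder.Language.Formula.iInf fun χ : F' => u χ.1)
      (FirstOrder.Language.Formula.realize_iInf.2 fun χ =>
        hu1 χ.1 (Finset.mem_filter.1 χ.2).1 (Finset.mem_filter.1 χ.2).2)
    refine ⟨d, fun χ hχ => ?_⟩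
    by_cases hne : χ = nφ
    · rw [hne, hnφ]; exact hd2
    · rw [← hu2 χ hχ hne, hup]
      exact FirstOrder.Language.Formula.realize_iInf.1 hd1 ⟨χ, Finset.mem_filter.2 ⟨hχ, hne⟩⟩
  obtain ⟨N₂, _, f₂, c₂, hc₂⟩ := exists_realization _ S hS
  have h1 := hc₂ nφ (Set.mem_insert _ _)
  rw [hnφ] at h1
  refine h1 (h N₂ f₂ c₂ fun ψ hψ => ?_)
  exact (hup _ _ _).1 (hc₂ _ (Or.inr ⟨_, hc ψ hψ, rfl⟩))

/-- A shredding witness of the default length yields alternating blocks of terms of the witness. -/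
theorem exists_blocks_of_isShredWitness {N : Type (max u v)} [L.Structure N] [Nonempty N]
    {A B : Set N} {m k n : ℕ} {φ : L.Formula (Fin m ⊕ Fin k)} {a : Fin k → N}
    {b : Set.Iio (defaultLength L A).ord → Fin n → N}
    (hwit : IsShredWitness (defaultLength L A) A φ a b) {χ : L.Formula (B ⊕ Fin m)}
    (hχφ : ∀ d : Fin m → N, χ.Realize (Sum.elim (Subtype.val : B → N) d) →
      φ.Realize (Sum.elim d a)) :
    ∃ (R n' : ℕ) (Ψ : L.Formula (Fin m ⊕ Fin (R + 1) × Fin n')) (b' : ℕ → Fin (R + 1) → Fin n' → N),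
      IsAlternating Ψ ∧ (∀ ξ q l, b' ξ q l ∈ A ∨ ∃ α l', b' ξ q l = b α l') ∧
      Indisc L (Subtype.val : A → N)
        (fun p : ℕ ×ₗ Fin (R + 1) => b' (ofLex p).1 (ofLex p).2) ∧
      ∀ ξ (d : Fin m → N), χ.Realize (Sum.elim (Subtype.val : B → N) d) →
        Ψ.Realize (Sum.elim d fun q => b' ξ q.1 q.2) := by
  let lam := defaultLength L A
  let μ := L.card + ℵ₀ + #A
  have hμ : ℵ₀ ≤ μ := le_add_self.trans le_self_add
  have hlam : lam.IsRegular := Cardinal.isRegular_succ hμ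
  have hinf : ℵ₀ ≤ lam := hlam.aleph0_le
  have e : Set.Iio lam.ord ≃o lam.ord.ToType := Ordinal.ToType.mk
  have : NoMaxOrder lam.ord.ToType := Cardinal.noMaxOrder hinf
  have : NoMaxOrder (Set.Iio lam.ord) := ⟨fun a => by
    obtain ⟨b, hb⟩ := exists_gt (e a)
    exact ⟨e.symm b, by rwa [OrderIso.lt_symm_apply]⟩⟩
  have : Nonempty (Set.Iio lam.ord) :=
    ⟨⟨0, (Ordinal.natCast_lt_omega0 0).trans_le (Cardinal.omega0_le_ord.2 hinf)⟩⟩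
  have hK : ∀ (X : Type (max u v)) (g : X → Set.Iio lam.ord), #X ≤ μ → ∃ k, ∀ x, g x < k := by
    intro X g hX
    obtain ⟨j, hj⟩ := exists_forall_lt_of_card_lt hlam (hX.trans_lt (Order.lt_succ _)) (e ∘ g)
    exact ⟨e.symm j, fun x => by rw [OrderIso.lt_symm_apply]; exact hj x⟩
  let χN : L.Formula (N ⊕ Fin m) := χ.relabel (Sum.map Subtype.val id)
  have hχN : ∀ {W : Type (max u v)} [L.Structure W] (g : N → W) (d : Fin m → W),
      χN.Realize (Sum.elim g d) ↔ χ.Realize (Sum.elim (fun b : B => g b) d) := by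
    intro W _ g d
    simp only [χN, FirstOrder.Language.Formula.realize_relabel, Sum.elim_comp_map]
    exact Iff.rfl
  obtain ⟨G, R, n', Ψ, b', hΨ, hb', hind, hGΨ⟩ := exists_alternating_blocks (L := L) (A := A)
    (S := {χN}) (id : Fin m → Fin m) (id : N → N) (β := b)
    (indiscernibleOver_iff.1 hwit.indiscernible) hμ (le_self_add.trans le_self_add)
    le_add_self (by simpa using Cardinal.one_le_aleph0.trans hμ) hK (by
      intro α hfin
      obtain ⟨N₂, _, f₂, z, hz⟩ := exists_realization _ _ hfin
      have h1 := tailIndisc_iff.1 fun χ hχ => hz χ (Or.inr hχ)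
      have h2 : χ.Realize (Sum.elim (f₂ ∘ (Subtype.val : B → N)) z) :=
        (hχN _ _).1 (hz χN (Or.inl rfl))
      have hsw : ∀ {W : Type (max u v)} [L.Structure W] (g : B → W) (d : Fin m → W),
          (χ.relabel Sum.swap).Realize (Sum.elim d g) ↔ χ.Realize (Sum.elim g d) := by
        intro W _ g d
        rw [FirstOrder.Language.Formula.realize_relabel]
        congr! 1
        funext x; rcases x with x | x <;> rfl
      have h3 := forall_imp_of_elementary f₂ (φ := χ.relabel Sum.swap) (ψ := φ)
        (g := (Subtype.val : B → N)) (h := a) (fun d hd => hχφ d ((hsw _ _).1 hd)) z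
        ((hsw _ _).2 h2)
      refine hwit.not_tail_indiscernible N₂ f₂ α z h3 (indiscernibleOver_iff.2 ?_)
      refine h1.of_range ?_
      rintro ⟨_, ⟨x, hx, rfl⟩ | ⟨l, rfl⟩⟩
      · exact ⟨Sum.inl ⟨x, hx⟩, rfl⟩
      · exact ⟨Sum.inr l, rfl⟩)
  refine ⟨R, n', Ψ, b', hΨ, hb', hind, fun ξ d hd => hGΨ ξ d fun ψ _ => ?_⟩
  rw [show ψ.1 = χN from ψ.2, hχN]
  exact hd

/-- The parameters of the shredding formula may lie outside M_(i+1), whereas a system needs them to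
be available at the next index. Hence the formula is first replaced by a stronger one over M_(i+1)
that still holds of the realization `c`. -/
theorem hasSystem_of_hasShreddingChain {T : L.Theory} {m : ℕ} {κ : Cardinal.{max u v}}
    (h : HasShreddingChain T m κ) : HasSystem T m κ := by
  obtain ⟨N, M, p, hmono, -, hshred⟩ := h
  obtain ⟨N', _, f, c, hc⟩ := exists_realizesType p
  have : Nonempty N' := (inferInstance : Nonempty N).map f
  refine hasSystem_of_sets ((f.theory_model_iff T).1 inferInstance)
    (fun i => f '' (M (pos i) : Set N)) c fun i => ?_
  obtain ⟨hsub, hAB, k, φ, a, n, b, himp, hwit, hbB⟩ := hshred (pos i) (pos_lt i)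
  obtain ⟨χ, hχc, hχφ⟩ := exists_formula_of_implies himp (hc _ hsub)
  obtain ⟨R, n', Ψ, b', hΨ, hb', hind, hχΨ⟩ := exists_blocks_of_isShredWitness hwit hχφ
  obtain ⟨k', e', φ', hφ'⟩ := exists_formula_of_finset.{u, v, _, max u v} (id : Fin m → Fin m) {χ}
  have hφ'' : ∀ {W : Type (max u v)} [L.Structure W] [Nonempty W] (g : (M (Order.succ (pos i)) : Set N) → W) (d : Fin m → W),
      φ'.Realize (Sum.elim d (g ∘ e')) ↔ χ.Realize (Sum.elim g d) := by
    intro W _ _ g d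
    rw [hφ']
    simp
  have hBj : ∀ j, i < j → (M (Order.succ (pos i)) : Set N) ⊆ M (pos j) := fun j hj =>
    hmono _ _ (Order.succ_le_of_lt (pos_lt_pos.2 hj)) (pos_lt j).le
  refine ⟨⟨k', R, n', φ', Ψ, hΨ⟩, fun l => f (e' l), fun ξ q l => f (b' ξ q l), ?_, ?_, ?_, ?_⟩
  · refine fun j hj => ⟨fun l => ⟨_, hBj j hj (e' l).2, rfl⟩, fun ξ q l => ⟨_, hBj j hj ?_, rfl⟩⟩
    rcases hb' ξ q l with h1 | ⟨α, l', h1⟩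
    · exact hAB h1
    · rw [h1]; exact hbB α l'
  · refine (hind.map f).of_range ?_
    rintro ⟨_, x, hx, rfl⟩
    exact ⟨⟨x, hx⟩, rfl⟩
  · intro ξ d hd
    refine forall_imp_of_elementary f (φ := φ') (ψ := Ψ) (g := fun l => (e' l : N))
      (h := fun q => b' ξ q.1 q.2) (fun d hd => ?_) d hd
    exact hχΨ ξ d ((hφ'' Subtype.val d).1 hd)
  · exact (hφ'' (fun b => f b) c).2 hχc

/-! ### Reducing the number of variables -/

/-- The union of `Γ` and the sets `T j α` selected by `D` at the indices in `s`. -/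
def selected {I : Type*} {K : I → Type*} {X : Type*} (Γ : Set X) (T : ∀ i, K i → Set X)
    (D : ∀ i, Option (K i)) (s : Set I) : Set X :=
  Γ ∪ {x | ∃ j ∈ s, ∃ α, D j = some α ∧ x ∈ T j α}

/-- A greedy choice of sets preserving finite satisfiability. -/
theorem exists_greedy {I : Type*} [LinearOrder I] [WellFoundedLT I] {K : I → Type*} {N P V : Type*}
    [L.Structure N] (g : P → N) (Γ : Set (L.Formula (P ⊕ V))) (hΓ : FinSat g Γ)
    (T : ∀ i, K i → Set (L.Formula (P ⊕ V))) :
    ∃ D : ∀ i, Option (K i), FinSat g (selected Γ T D Set.univ) ∧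
      ∀ i, D i = none → ∀ α, ¬ FinSat g (selected Γ T D (Set.Iio i) ∪ T i α) := by
  classical
  let F : ∀ i, (∀ j, j < i → Option (K j)) → Option (K i) := fun i D =>
    if h : ∃ α, FinSat g
      ((Γ ∪ {x | ∃ j, ∃ hj : j < i, ∃ α, D j hj = some α ∧ x ∈ T j α}) ∪ T i α)
    then some h.choose else none
  let D : ∀ i, Option (K i) := (wellFounded_lt (α := I)).fix F
  have hD : ∀ i, D i = if h : ∃ α, FinSat g (selected Γ T D (Set.Iio i) ∪ T i α)
      then some h.choose else none := by
    intro i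
    have h1 : D i = F i fun j _ => D j := WellFounded.fix_eq _ F i
    rw [h1]
    simp only [F, selected, Set.mem_Iio, exists_prop]
  have hsome : ∀ i α, D i = some α → FinSat g (selected Γ T D (Set.Iio i) ∪ T i α) := by
    intro i α hα
    rw [hD] at hα
    split_ifs at hα with h
    · rw [← Option.some.inj hα]
      exact h.choose_spec
  refine ⟨D, fun E hE => ?_, fun i hi α hα => ?_⟩
  · rcases (E.filter (· ∉ Γ)).eq_empty_or_nonempty with hemp | hne
    · refine hΓ E fun x hx => ?_
      by_contra hxΓ
      have : x ∈ E.filter (· ∉ Γ) := Finset.mem_filter.2 ⟨hx, hxΓ⟩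
      rw [hemp] at this
      exact absurd this (Finset.notMem_empty x)
    · have hj : ∀ x ∈ E.filter (· ∉ Γ), ∃ j α, D j = some α ∧ x ∈ T j α := by
        intro x hx
        obtain ⟨hxE, hxΓ⟩ := Finset.mem_filter.1 hx
        obtain ⟨j, -, α, h⟩ := (hE hxE).resolve_left hxΓ
        exact ⟨j, α, h⟩
      have : Nonempty I := by
        obtain ⟨x, hx⟩ := hne
        exact ⟨(hj x hx).choose⟩
      choose! j hj using hj
      -- The finite set is contained in what was consistent at the stage of its largest index.
      obtain ⟨x₀, hx₀, hmax⟩ := Finset.exists_max_image _ j hne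
      obtain ⟨α₀, hα₀, -⟩ := hj x₀ hx₀
      refine hsome _ α₀ hα₀ E fun x hx => ?_
      by_cases hxΓ : x ∈ Γ
      · exact Or.inl (Or.inl hxΓ)
      have hx' : x ∈ E.filter (· ∉ Γ) := Finset.mem_filter.2 ⟨hx, hxΓ⟩
      obtain ⟨α, hα, hxα⟩ := hj x hx'
      rcases (hmax x hx').lt_or_eq with hlt | heq
      · exact Or.inl (Or.inr ⟨j x, hlt, α, hα, hxα⟩)
      · refine Or.inr ?_
        have h2 : ∀ {j'} (_ : j' = j x₀) (α' : K j'), D j' = some α' → x ∈ T j' α' →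
            x ∈ T (j x₀) α₀ := by
          rintro _ rfl α' h h'
          rw [hα₀] at h
          rwa [Option.some.inj h]
        exact h2 heq α hα hxα
  · rw [hD, dif_pos ⟨α, hα⟩] at hi
    exact absurd hi (Option.some_ne_none _)

/-- By recursion: fewer than κ values of `J` have been produced before stage `i`, so regularity
bounds them, and the cofinal set `S` has an element above the bound. -/
theorem exists_thinning {κ : Cardinal.{w}} (hκ : κ.IsRegular) {S : Set κ.ord.ToType}
    (hS : ∀ i, ∃ s ∈ S, i ≤ s) (J : κ.ord.ToType → κ.ord.ToType) :
    ∃ h : κ.ord.ToType → κ.ord.ToType, ∀ i, h i ∈ S ∧ ∀ i' < i, J (h i') ≤ h i := by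
  have H : ∀ (i : κ.ord.ToType) (h : ∀ i', i' < i → κ.ord.ToType),
      ∃ s ∈ S, ∀ i' (hi : i' < i), J (h i' hi) ≤ s := by
    intro i h
    have hi : #(Set.Iio i) < κ := by
      simpa using Cardinal.mk_Iio_lt i (by simp)
    obtain ⟨j, hj⟩ := exists_forall_lt_of_card_lt hκ hi
      (fun i' : Set.Iio i => J (h i'.1 i'.2))
    obtain ⟨s, hs, hjs⟩ := hS j
    exact ⟨s, hs, fun i' hi => (hj ⟨i', hi⟩).le.trans hjs⟩
  choose F hF using H
  refine ⟨(wellFounded_lt (α := κ.ord.ToType)).fix F, fun i => ?_⟩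
  rw [WellFounded.fix_eq _ F i]
  exact hF i _

/-- The data at `i` may only become available at a later `j`. Thinning the index set so that each
chosen index lies beyond those `j` restores the requirement of a system without shortening it. -/
theorem hasSystem_of_cofinal {T : L.Theory} {m : ℕ} {κ : Cardinal.{max u v}} (hκ : κ.IsRegular)
    {N : Type (max u v)} [L.Structure N] [Nonempty N] (hT : N ⊨ T)
    {A : κ.ord.ToType → Set N} (hA : Monotone A) (c : Fin m → N) {S : Set κ.ord.ToType}
    (hS : ∀ i, ∃ s ∈ S, i ≤ s)
    (H : ∀ i ∈ S, ∃ (j : κ.ord.ToType) (P : Pattern L m) (a : Fin P.k → N)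
      (b : ℕ → Fin (P.R + 1) → Fin P.n → N),
      ((∀ l, a l ∈ A j) ∧ ∀ ξ q l, b ξ q l ∈ A j) ∧
      Indisc L (Subtype.val : A i → N)
        (fun p : ℕ ×ₗ Fin (P.R + 1) => b (ofLex p).1 (ofLex p).2) ∧
      (∀ ξ (d : Fin m → N), P.φ.Realize (Sum.elim d a) →
        P.Ψ.Realize (Sum.elim d fun q => b ξ q.1 q.2)) ∧
      P.φ.Realize (Sum.elim c a)) : HasSystem T m κ := by
  have : Nonempty κ.ord.ToType := Cardinal.mk_ne_zero_iff.1 (by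
    rw [Cardinal.mk_ord_toType]; exact hκ.pos.ne')
  choose! J H using H
  obtain ⟨h, hh⟩ := exists_thinning hκ hS J
  refine hasSystem_of_sets hT (A ∘ h) c fun i => ?_
  obtain ⟨P, a, b, ⟨ha, hb⟩, hP⟩ := H (h i) (hh i).1
  exact ⟨P, a, b, fun j hj => ⟨fun l => hA ((hh j).2 i hj) (ha l),
    fun ξ q l => hA ((hh j).2 i hj) (hb ξ q l)⟩, hP⟩

theorem mk_tailIndisc_le {m m' n : ℕ} (ρ : Fin m → Fin m') {P : Type (max u v)}
    {K : Type (max u v)} [LinearOrder K] (A : Set P) (β : K → Fin n → P) (α : K)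
    {μ : Cardinal.{max u v}} (hμ : ℵ₀ ≤ μ) (hL : L.card ≤ μ) (hA : #A ≤ μ) (hK : #K ≤ μ) :
    #(tailIndisc (L := L) ρ A β α) ≤ μ := by
  let X := Σ k r : ℕ, L.Formula ((Fin k ⊕ Fin m) ⊕ Fin r × Fin n) × (Fin k → A) ×
    (Fin r → K) × (Fin r → K)
  let F : X → L.Formula (P ⊕ Fin m') := fun x =>
    indInstance ρ β x.2.2.1 (fun i => (x.2.2.2.1 i : P)) x.2.2.2.2.1 x.2.2.2.2.2
  have hsub : tailIndisc (L := L) ρ A β α ⊆ Set.range F := by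
    rintro _ ⟨k, r, ψ, e, s, t, he, -, -, -, -, rfl⟩
    exact ⟨⟨k, r, ψ, fun i => ⟨e i, he i⟩, s, t⟩, rfl⟩
  have hpow : ∀ (Y : Type (max u v)) (k : ℕ), #Y ≤ μ → #(Fin k → Y) ≤ μ := by
    intro Y k hY
    have : #(Fin k → Y) = #Y ^ k := by simp
    rw [this]
    exact (Cardinal.power_le_power_right hY).trans (Cardinal.power_nat_le hμ)
  refine (Cardinal.mk_le_mk_of_subset hsub).trans (Cardinal.mk_range_le.trans ?_)
  refine mk_sigma_nat_le hμ fun k => mk_sigma_nat_le hμ fun r => ?_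
  simp only [Cardinal.mk_prod, Cardinal.lift_id]
  exact Cardinal.mul_le_of_le hμ (mk_formula_le hμ hL _) (Cardinal.mul_le_of_le hμ (hpow _ _ hA)
    (Cardinal.mul_le_of_le hμ (hpow _ _ hK) (hpow _ _ hK)))

theorem mk_selected_le {I X : Type w} {K : I → Type x} {Γ : Set X} {T : ∀ i, K i → Set X}
    {D : ∀ i, Option (K i)} {s : Set I} {μ : Cardinal.{w}} (hμ : ℵ₀ ≤ μ) (hΓ : #Γ ≤ μ)
    (hs : #s ≤ μ) (hT : ∀ j ∈ s, ∀ α, #(T j α) ≤ μ) : #(selected Γ T D s) ≤ μ := by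
  have hsub : selected Γ T D s ⊆ Γ ∪ ⋃ j : s, {x | ∃ α, D j = some α ∧ x ∈ T j α} := by
    rintro x (hx | ⟨j, hj, hx⟩)
    · exact Or.inl hx
    · exact Or.inr (Set.mem_iUnion.2 ⟨⟨j, hj⟩, hx⟩)
  refine (Cardinal.mk_le_mk_of_subset hsub).trans ((Cardinal.mk_union_le _ _).trans
    (Cardinal.add_le_of_le hμ hΓ ?_))
  refine (Cardinal.mk_iUnion_le_sum_mk).trans ((Cardinal.sum_le_sum _ (fun _ => μ) ?_).trans ?_)
  · rintro ⟨j, hj⟩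
    rcases hDj : D j with _ | α
    · simp
    · refine (Cardinal.mk_le_mk_of_subset ?_).trans (hT j hj α)
      rintro x ⟨α', hα', hx⟩
      rwa [Option.some.inj hα']
  · rw [Cardinal.sum_const, Cardinal.lift_id, Cardinal.lift_id]
    exact Cardinal.mul_le_of_le hμ hs le_rfl

section Reduction

variable {m : ℕ} {κ : Cardinal.{max u v}} {ν : Ordinal.{max u v}}

/-- The names below `i`. -/
def genBelow {m : ℕ} {I : Type w} [LinearOrder I] (P : I → Pattern L m) (J : I → Type x) (i : I) :
    Set (Gen P J) := {g | g.1 < i}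

/-- The names of the terms of the `i`-th sequence. -/
def seqName {m : ℕ} {I : Type w} (P : I → Pattern L m) (J : I → Type x) (i : I)
    (p : J i ×ₗ Fin ((P i).R + 1)) (l : Fin (P i).n) : Gen P J := ⟨i, Sum.inr (p, l)⟩

/-- The formulas `φ_i(x; a_i)`. -/
def satFormula {m : ℕ} {I : Type w} (P : I → Pattern L m) (J : I → Type x) (i : I) :
    L.Formula (Gen P J ⊕ Fin m) :=
  (P i).φ.relabel (Sum.elim Sum.inr fun l => Sum.inl ⟨i, Sum.inl l⟩)

theorem realize_satFormula {m : ℕ} {I : Type w} (P : I → Pattern L m) (J : I → Type x) (i : I)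
    {N : Type y} [L.Structure N] (z : Gen P J → N) (c : Fin m → N) :
    (satFormula P J i).Realize (Sum.elim z c) ↔
      (P i).φ.Realize (Sum.elim c fun l => z ⟨i, Sum.inl l⟩) := by
  rw [satFormula, FirstOrder.Language.Formula.realize_relabel, Sum.comp_elim]
  exact Iff.rfl

theorem mk_genBelow_le (hκ : κ ≤ ℵ_ ν) (P : κ.ord.ToType → Pattern L m) (i : κ.ord.ToType) :
    #(genBelow P (LenIdx ν) i) ≤ ℵ_ (ν + pos i) := by
  refine (Cardinal.mk_le_mk_of_subset ?_).trans (mk_gen_lt_le hκ P (pos i))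
  exact fun g hg => pos_lt_pos.2 hg

theorem mk_lenIdx_lex_le {κ : Cardinal.{w}} {ν : Ordinal.{w}} {i j : κ.ord.ToType} (hij : j < i) (R : ℕ) :
    #(LenIdx ν j ×ₗ Fin (R + 1)) ≤ ℵ_ (ν + pos i) := by
  have h0 : ℵ₀ ≤ ℵ_ (ν + pos i) := Cardinal.aleph0_le_aleph _
  have hl : #(LenIdx ν j) ≤ ℵ_ (ν + pos i) := by
    rw [Cardinal.mk_ord_toType, len, Cardinal.succ_aleph, Cardinal.aleph_le_aleph, add_assoc]
    exact add_le_add_right (Order.add_one_le_of_lt (pos_lt_pos.2 hij)) _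
  have hlex : #(LenIdx ν j ×ₗ Fin (R + 1)) = #(LenIdx ν j × Fin (R + 1)) := rfl
  rw [hlex, Cardinal.mk_prod, Cardinal.mk_fin, Cardinal.lift_natCast, Cardinal.lift_uzero]
  exact Cardinal.mul_le_of_le h0 hl (Cardinal.natCast_lt_aleph0.le.trans h0)

theorem exists_forall_lt_lex {κ : Cardinal.{w}} {ν : Ordinal.{w}} (i : κ.ord.ToType) (R : ℕ)
    (X : Type w)
    (hX : #X ≤ ℵ_ (ν + pos i)) (f : X → LenIdx ν i ×ₗ Fin (R + 1)) : ∃ k, ∀ x, f x < k := by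
  obtain ⟨k, hk⟩ := exists_forall_lt_of_card_lt (isRegular_len ν i)
    (hX.trans_lt (Order.lt_succ _)) (fun x => (ofLex (f x)).1)
  exact ⟨toLex (k, 0), fun x => Prod.Lex.lt_iff.2 (Or.inl (hk x))⟩

instance {α : Type*} {β : Type*} [LinearOrder α] [NoMaxOrder α] [LinearOrder β] [Nonempty β] :
    NoMaxOrder (α ×ₗ β) where
  exists_gt p := by
    obtain ⟨a, ha⟩ := exists_gt (ofLex p).1
    exact ⟨toLex (a, Classical.arbitrary β), Prod.Lex.lt_iff.2 (Or.inl ha)⟩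

instance {α : Type*} {β : Type*} [Nonempty α] [Nonempty β] : Nonempty (α ×ₗ β) :=
  inferInstanceAs (Nonempty (α × β))

/-- The tail sets considered in the reduction. -/
abbrev seqTail (P : κ.ord.ToType → Pattern L (m + 1)) (ν : Ordinal.{max u v}) (i : κ.ord.ToType)
    (α : LenIdx ν i ×ₗ Fin ((P i).R + 1)) :
    Set (L.Formula (Gen P (LenIdx ν) ⊕ Fin (m + 1))) :=
  tailIndisc (Fin.castSucc : Fin m → Fin (m + 1)) (genBelow P (LenIdx ν) i)
    (seqName P (LenIdx ν) i) α

/-- The growth of the lengths is needed here: the formulas selected before `i` are fewer than the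
length of the i-th sequence, as `exists_alternating_blocks` demands. -/
theorem mk_selected_seqTail_le (hκ : κ ≤ ℵ_ ν) (hL : L.card ≤ ℵ_ ν)
    (P : κ.ord.ToType → Pattern L (m + 1))
    (D : ∀ i : κ.ord.ToType, Option (LenIdx ν i ×ₗ Fin ((P i).R + 1))) (i : κ.ord.ToType) :
    #(selected (Set.range (satFormula P (LenIdx ν))) (seqTail P ν) D (Set.Iio i)) ≤
      ℵ_ (ν + pos i) := by
  have h0 : ℵ₀ ≤ ℵ_ (ν + pos i) := Cardinal.aleph0_le_aleph _
  have hν : ℵ_ ν ≤ ℵ_ (ν + pos i) := Cardinal.aleph_le_aleph.2 le_self_add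
  have hκ' : #κ.ord.ToType ≤ ℵ_ (ν + pos i) := by
    rw [Cardinal.mk_ord_toType]; exact hκ.trans hν
  refine mk_selected_le h0 (Cardinal.mk_range_le.trans hκ')
    ((Cardinal.mk_subtype_le _).trans hκ') fun j hj α => ?_
  refine mk_tailIndisc_le _ _ _ α h0 (hL.trans hν) ((mk_genBelow_le hκ P j).trans ?_)
    (mk_lenIdx_lex_le hj _)
  exact Cardinal.aleph_le_aleph.2 (add_le_add_right (pos_lt_pos.2 hj).le _)

end Reduction

theorem exists_forall_fst_lt {I : Type w} [LinearOrder I] [NoMaxOrder I] {k : ℕ} (f : Fin k → I)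
    (i : I) : ∃ j, i < j ∧ ∀ l, f l < j := by
  have : Nonempty I := ⟨i⟩
  obtain ⟨b, hb⟩ := (Set.finite_range f).bddAbove
  obtain ⟨j, hj⟩ := exists_gt (max b i)
  exact ⟨j, (le_max_right _ _).trans_lt hj,
    fun l => ((hb ⟨l, rfl⟩).trans (le_max_left _ _)).trans_lt hj⟩

/-- If cofinally often the next tail set cannot be added consistently, then all variables but
the last one carry a system. -/
theorem hasSystem_of_none_cofinal {T : L.Theory} {m : ℕ} {κ : Cardinal.{max u v}}
    {ν : Ordinal.{max u v}} (hκ : κ.IsRegular) (hκν : κ ≤ ℵ_ ν) (hL : L.card ≤ ℵ_ ν)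
    {P : κ.ord.ToType → Pattern L (m + 1)} {N : Type (max u v)} [L.Structure N] [Nonempty N]
    (hT : N ⊨ T) {z : Gen P (LenIdx ν) → N} {c : Fin (m + 1) → N}
    (hsys : IsSystem P (LenIdx ν) z c)
    {D : ∀ i : κ.ord.ToType, Option (LenIdx ν i ×ₗ Fin ((P i).R + 1))}
    (hD : ∀ i, D i = none → ∀ α, ¬ FinSat z
      (selected (Set.range (satFormula P (LenIdx ν))) (seqTail P ν) D (Set.Iio i) ∪
        seqTail P ν i α))
    (hcof : ∀ i, ∃ s ∈ {s | D s = none}, i ≤ s)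
    {N' : Type (max u v)} [L.Structure N'] (f : N ↪ₑ[L] N') (d : Fin (m + 1) → N')
    (hd : ∀ ψ ∈ selected (Set.range (satFormula P (LenIdx ν))) (seqTail P ν) D Set.univ,
      ψ.Realize (Sum.elim (f ∘ z) d)) : HasSystem T m κ := by
  classical
  have : Nonempty N' := (inferInstance : Nonempty N).map f
  have : NoMaxOrder κ.ord.ToType := Cardinal.noMaxOrder hκ.aleph0_le
  refine hasSystem_of_cofinal hκ ((f.theory_model_iff T).1 hT)
    (A := fun i => (f ∘ z) '' genBelow P (LenIdx ν) i)
    (fun i j hij => Set.image_mono fun g hg => lt_of_lt_of_le hg hij) (d ∘ Fin.castSucc) hcof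
    fun i hi => ?_
  obtain ⟨G, R, n', Ψ, b, hΨ, hb, hind, hGΨ⟩ := exists_alternating_blocks
    (A := genBelow P (LenIdx ν) i) (β := seqName P (LenIdx ν) i) (Fin.castSucc : Fin m → Fin (m + 1)) z
    (hsys.indisc i) (Cardinal.aleph0_le_aleph (ν + pos i))
    (hL.trans (Cardinal.aleph_le_aleph.2 le_self_add)) (mk_genBelow_le hκν P i)
    (mk_selected_seqTail_le hκν hL P D i) (fun X g hX => exists_forall_lt_lex i _ X hX g) (hD i hi)
  -- `φ` quantifies the last variable out of the conjunction of `G`; this is allowed because `Ψ`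
  -- mentions only the first m variables.
  obtain ⟨k, e, φ, hφ⟩ := exists_formula_of_finset.{u, v, max u v, max u v}
    (Fin.castSucc : Fin m → Fin (m + 1)) (G.map (Function.Embedding.subtype _))
  -- `G` may involve φ_j for j beyond `i`, so the parameters need not lie just above `i`.
  obtain ⟨j, hij, hj⟩ := exists_forall_fst_lt (fun l => (e l).1) i
  refine ⟨j, ⟨k, R, n', φ, Ψ, hΨ⟩, fun l => f (z (e l)), fun ξ q l => f (z (b ξ q l)),
    ⟨fun l => ⟨_, hj l, rfl⟩, fun ξ q l => ⟨_, ?_, rfl⟩⟩, ?_, fun ξ x hx => ?_, ?_⟩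
  · rcases hb ξ q l with h | ⟨p, l', h⟩
    · exact lt_trans h hij
    · rw [h]; exact hij
  · refine (hind.map f).of_range ?_
    rintro ⟨_, g, hg, rfl⟩
    exact ⟨⟨g, hg⟩, rfl⟩
  · refine forall_imp_of_elementary f (φ := φ) (ψ := Ψ) (g := z ∘ e)
      (h := fun q => z (b ξ q.1 q.2)) (fun y hy => ?_) x hx
    obtain ⟨y', rfl, hy'⟩ := (hφ N z y).1 hy
    exact hGΨ ξ y' fun ψ hψ => hy' ψ.1 (Finset.mem_map_of_mem (Function.Embedding.subtype _) hψ)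
  · refine (hφ N' (f ∘ z) _).2 ⟨d, rfl, fun ψ hψ => hd ψ ?_⟩
    obtain ⟨⟨ψ, hψ'⟩, -, rfl⟩ := Finset.mem_map.1 hψ
    rcases hψ' with h | ⟨j, -, h⟩
    · exact Or.inl h
    · exact Or.inr ⟨j, trivial, h⟩

/-- Turning all variables but the last one into parameters. -/
theorem exists_pattern_of_last {m : ℕ} (P : Pattern L (m + 1)) :
    ∃ (φ : L.Formula (Fin 1 ⊕ Fin (P.k + m))) (Ψ : L.Formula (Fin 1 ⊕ Fin (P.R + 1) × Fin (P.n + m))),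
      IsAlternating Ψ ∧ ∀ (N : Type (max u v)) [L.Structure N] (x : Fin 1 → N) (e : Fin m → N),
        (∀ a : Fin P.k → N, φ.Realize (Sum.elim x (Fin.append a e)) ↔
          P.φ.Realize (Sum.elim (Fin.snoc (α := fun _ => N) e (x 0) : Fin (m + 1) → N) a)) ∧
        ∀ b : Fin (P.R + 1) → Fin P.n → N,
          Ψ.Realize (Sum.elim x fun q => Fin.append (b q.1) e q.2) ↔
          P.Ψ.Realize (Sum.elim (Fin.snoc (α := fun _ => N) e (x 0) : Fin (m + 1) → N)
            fun q => b q.1 q.2) := by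
  let s : Fin (m + 1) → Fin 1 ⊕ Fin m := Fin.lastCases (Sum.inl 0) Sum.inr
  have hs : ∀ {N : Type (max u v)} (x : Fin 1 → N) (e : Fin m → N),
      Sum.elim x e ∘ s = (Fin.snoc (α := fun _ => N) e (x 0) : Fin (m + 1) → N) := by
    intro N x e
    funext i
    refine Fin.lastCases ?_ (fun i => ?_) i <;> simp [s]
  let Θ : L.Formula (Fin 1 ⊕ (Fin m ⊕ Fin (P.R + 1) × Fin P.n)) :=
    P.Ψ.relabel (Sum.elim (Sum.map id Sum.inl ∘ s) (fun q => Sum.inr (Sum.inr q)))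
  have hΘ : ∀ (N : Type (max u v)) [L.Structure N] (x : Fin 1 → N) (e : Fin m → N)
      (b : Fin (P.R + 1) → Fin P.n → N),
      Θ.Realize (Sum.elim x (Sum.elim e fun q => b q.1 q.2)) ↔
      P.Ψ.Realize (Sum.elim (Fin.snoc (α := fun _ => N) e (x 0) : Fin (m + 1) → N)
            fun q => b q.1 q.2) := by
    intro N _ x e b
    rw [FirstOrder.Language.Formula.realize_relabel, Sum.comp_elim, ← Function.comp_assoc,
      Sum.elim_comp_map, Sum.elim_comp_inl, Function.comp_id, hs]
    exact Iff.rfl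
  obtain ⟨Ψ, hΨ, hΨΘ⟩ := exists_alternating_absorb Θ (by
    intro N _ x e b hb hr
    refine P.alternating N _ b (hb.of_range fun i => ?_) ((hΘ N x e b).1 hr)
    exact ⟨s i, congrFun (hs x e) i⟩)
  refine ⟨P.φ.relabel (Sum.elim (Sum.map id (Fin.natAdd P.k) ∘ s)
    (fun l => Sum.inr (Fin.castAdd m l))), Ψ, hΨ, fun N _ x e => ⟨fun a => ?_, fun b => ?_⟩⟩
  · rw [FirstOrder.Language.Formula.realize_relabel, Sum.comp_elim, ← Function.comp_assoc,
      Sum.elim_comp_map, Function.comp_id]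
    have h1 : Fin.append a e ∘ Fin.natAdd P.k = e := by funext i; simp
    have h2 : (Sum.elim x (Fin.append a e) ∘ fun l => Sum.inr (Fin.castAdd m l)) = a := by
      funext i; simp
    rw [h1, h2, hs]
  · rw [hΨΘ, hΘ]

/-- If from some point on all tail sets have been added, then the last variable carries a system
over the others. -/
theorem hasSystem_one_of_some {T : L.Theory} {m : ℕ} {κ : Cardinal.{max u v}}
    {ν : Ordinal.{max u v}} (hκ : κ.IsRegular)
    {P : κ.ord.ToType → Pattern L (m + 1)} {N : Type (max u v)} [L.Structure N] [Nonempty N]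
    (hT : N ⊨ T) {z : Gen P (LenIdx ν) → N} {c : Fin (m + 1) → N}
    (hsys : IsSystem P (LenIdx ν) z c)
    {D : ∀ i : κ.ord.ToType, Option (LenIdx ν i ×ₗ Fin ((P i).R + 1))} {i₀ : κ.ord.ToType}
    (hD : ∀ i, i₀ ≤ i → D i ≠ none)
    {N' : Type (max u v)} [L.Structure N'] (f : N ↪ₑ[L] N') (d : Fin (m + 1) → N')
    (hd : ∀ ψ ∈ selected (Set.range (satFormula P (LenIdx ν))) (seqTail P ν) D Set.univ,
      ψ.Realize (Sum.elim (f ∘ z) d)) : HasSystem T 1 κ := by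
  have : Nonempty N' := (inferInstance : Nonempty N).map f
  have : NoMaxOrder κ.ord.ToType := Cardinal.noMaxOrder hκ.aleph0_le
  let e : Fin m → N' := d ∘ Fin.castSucc
  have hsnoc : (Fin.snoc (α := fun _ => N') e (d (Fin.last m)) : Fin (m + 1) → N') = d :=
    Fin.snoc_init_self d
  have hsys' := hsys.map f
  refine hasSystem_of_cofinal hκ ((f.theory_model_iff T).1 hT)
    (A := fun i => (f ∘ z) '' genBelow P (LenIdx ν) i ∪ Set.range e)
    (fun i j hij => Set.union_subset_union_left _
      (Set.image_mono fun g hg => lt_of_lt_of_le hg hij)) (fun _ => d (Fin.last m))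
    (S := Set.Ici i₀) (fun i => ⟨max i₀ i, le_max_left i₀ i, le_max_right i₀ i⟩) fun i hi => ?_
  obtain ⟨α, hα⟩ := Option.ne_none_iff_exists'.1 (hD i hi)
  have hind := (tailIndisc_iff (g := f ∘ z) (d := d)).1 fun χ hχ =>
    hd χ (Or.inr ⟨i, trivial, α, hα, hχ⟩)
  obtain ⟨φ, Ψ, hΨ, hφΨ⟩ := exists_pattern_of_last (P i)
  obtain ⟨j, hij⟩ := exists_gt i
  -- `α` may lie in the middle of a block, so only blocks strictly after its own are used.
  obtain ⟨α', hα'⟩ := exists_gt (ofLex α).1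
  obtain ⟨σ, hσ, hσ0⟩ := Nat.exists_strictMono' α'
  have hσα : ∀ ξ, (ofLex α).1 < σ ξ := fun ξ =>
    hα'.trans_le (hσ0.symm.le.trans (hσ.monotone (Nat.zero_le ξ)))
  refine ⟨j, ⟨(P i).k + m, (P i).R, (P i).n + m, φ, Ψ, hΨ⟩,
    Fin.append (fun l => f (z ⟨i, Sum.inl l⟩)) e,
    fun ξ q => Fin.append (fun l => f (z ⟨i, Sum.inr (toLex (σ ξ, q), l)⟩)) e,
    ⟨fun l => ?_, fun ξ q l => ?_⟩, ?_, fun ξ x hx => ?_, ?_⟩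
  · refine Fin.addCases (fun l => ?_) (fun l => ?_) l
    · rw [Fin.append_left]; exact Or.inl ⟨_, hij, rfl⟩
    · rw [Fin.append_right]; exact Or.inr ⟨l, rfl⟩
  · refine Fin.addCases (fun l => ?_) (fun l => ?_) l
    · beta_reduce; rw [Fin.append_left]; exact Or.inl ⟨_, hij, rfl⟩
    · beta_reduce; rw [Fin.append_right]; exact Or.inr ⟨l, rfl⟩
  · have h1 := hind.of_range (g' := (Subtype.val : ↥((f ∘ z) '' genBelow P (LenIdx ν) i ∪
      Set.range e) → N')) (by
        rintro ⟨_, ⟨g, hg, rfl⟩ | ⟨l, rfl⟩⟩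
        · exact ⟨Sum.inl ⟨g, hg⟩, rfl⟩
        · exact ⟨Sum.inr l, rfl⟩)
    let τ : ℕ ×ₗ Fin ((P i).R + 1) → Set.Ici α := fun p =>
      ⟨toLex (σ (ofLex p).1, (ofLex p).2), 
        Set.mem_Ici.2 (Prod.Lex.lt_iff.2 (Or.inl (hσα _))).le⟩
    have hτ : StrictMono τ := fun p q hpq => lex_map_strictMono hσ hpq
    exact (h1.comp_strictMono hτ).append fun l => ⟨⟨e l, Or.inr ⟨l, rfl⟩⟩, rfl⟩
  · rw [(hφΨ N' x e).1] at hx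
    exact ((hφΨ N' x e).2 fun q l => f (z ⟨i, Sum.inr (toLex (σ ξ, q), l)⟩)).2
      (hsys'.imp i (σ ξ) _ hx)
  · refine ((hφΨ N' _ e).1 _).2 ?_
    rw [hsnoc]
    exact (realize_satFormula P _ i (f ∘ z) d).1 (hd _ (Or.inl ⟨i, rfl⟩))

/-- Stretching comes first so that each sequence is longer than everything selected before it. The
greedy choice then fails cofinally often, which gives m variables, or succeeds from some point on,
which gives one. -/
theorem hasSystem_succ {T : L.Theory} {m : ℕ} {κ : Cardinal.{max u v}} (hκ : κ.IsRegular)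
    (h : HasSystem T (m + 1) κ) : HasSystem T m κ ∨ HasSystem T 1 κ := by
  obtain ⟨N₀, _, P, z₀, c₀, _, hT₀, hsys₀⟩ := h
  obtain ⟨ν, hν⟩ : ∃ ν : Ordinal.{max u v}, ℵ_ ν = (κ + L.card) + ℵ₀ :=
    Cardinal.mem_range_aleph_iff.2 le_add_self
  have hκν : κ ≤ ℵ_ ν := hν ▸ le_self_add.trans le_self_add
  have hL : L.card ≤ ℵ_ ν := hν ▸ le_add_self.trans le_self_add
  obtain ⟨N, _, f₀, z, hsys⟩ := hsys₀.stretch (LenIdx ν)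
  have : Nonempty N := (inferInstance : Nonempty N₀).map f₀
  have hT : N ⊨ T := (f₀.theory_model_iff T).1 hT₀
  have hΓ : FinSat z (Set.range (satFormula P (LenIdx ν))) := by
    refine fun F hF => ⟨f₀ ∘ c₀, fun ψ hψ => ?_⟩
    obtain ⟨i, rfl⟩ := hF hψ
    exact (realize_satFormula _ _ _ _ _).2 (hsys.sat i)
  obtain ⟨D, hD, hDnone⟩ := exists_greedy z _ hΓ (seqTail P ν)
  obtain ⟨N', _, f, d, hd⟩ := exists_realization z _ hD
  by_cases hcof : ∀ i, ∃ s ∈ {s | D s = none}, i ≤ s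
  · exact Or.inl (hasSystem_of_none_cofinal hκ hκν hL hT hsys hDnone hcof f d hd)
  · push Not at hcof
    obtain ⟨i₀, hi₀⟩ := hcof
    exact Or.inr (hasSystem_one_of_some hκ hT hsys (i₀ := i₀)
      (fun i hi hn => absurd hi (hi₀ i hn).not_ge) f d hd)

/-- Indiscernibility over the earlier names already includes indiscernibility over the empty tuple,
which contradicts the alternating formula on any block. -/
theorem not_hasSystem_zero {T : L.Theory} {κ : Cardinal.{max u v}} (hκ : κ.IsRegular) :
    ¬ HasSystem T 0 κ := by
  rintro ⟨N, _, P, z, c, _, -, hsys⟩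
  have : Nonempty κ.ord.ToType := Cardinal.mk_ne_zero_iff.1 (by
    rw [Cardinal.mk_ord_toType]; exact hκ.pos.ne')
  obtain ⟨i⟩ := this
  refine (P i).alternating N c (fun q l => z ⟨i, Sum.inr (toLex (0, q), l)⟩) ?_
    (hsys.imp i 0 c (hsys.sat i))
  have h1 := (hsys.indisc i).of_range (g' := c) fun j => j.elim0
  exact h1.comp_strictMono (f := fun q : Fin ((P i).R + 1) =>
    (toLex (0, q) : ℕ ×ₗ Fin ((P i).R + 1))) fun p q hpq => Prod.Lex.lt_iff.2 (Or.inr ⟨rfl, hpq⟩)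

/-- All variables but the first are dummies. A sequence indiscernible over a tuple is indiscernible
over its first coordinate, so the formulas remain alternating. -/
theorem HasSystem.of_one {T : L.Theory} {m : ℕ} (hm : 1 ≤ m) {κ : Cardinal.{max u v}}
    (h : HasSystem T 1 κ) : HasSystem T m κ := by
  obtain ⟨N, _, P, z, c, hN, hT, hsys⟩ := h
  let j : Fin 1 → Fin m := fun _ => ⟨0, hm⟩
  have key : ∀ {M : Type (max u v)} [L.Structure M] {α : Type} (φ : L.Formula (Fin 1 ⊕ α))
      (x : Fin m → M) (a : α → M), (φ.relabel (Sum.map j id)).Realize (Sum.elim x a) ↔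
        φ.Realize (Sum.elim (x ∘ j) a) := by
    intro M _ α φ x a
    rw [FirstOrder.Language.Formula.realize_relabel, Sum.elim_comp_map, Function.comp_id]
  have hc : (fun _ : Fin m => c 0) ∘ j = c := by
    funext i; rw [Subsingleton.elim i 0]; rfl
  refine ⟨N, inferInstance, fun i => ⟨(P i).k, (P i).R, (P i).n, (P i).φ.relabel (Sum.map j id),
    (P i).Ψ.relabel (Sum.map j id), fun M _ x b hb hr => ?_⟩, z, fun _ => c 0, hN, hT,
    hsys.indisc, fun i ξ d hd => (key _ _ _).2 (hsys.imp i ξ _ ((key _ _ _).1 hd)),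
    fun i => (key _ _ _).2 ?_⟩
  · exact (P i).alternating M (x ∘ j) b (hb.of_range fun p => ⟨j p, rfl⟩) ((key _ _ _).1 hr)
  · rw [hc]; exact hsys.sat i

theorem HasSystem.one {T : L.Theory} {m : ℕ} {κ : Cardinal.{max u v}} (hκ : κ.IsRegular)
    (h : HasSystem T m κ) : HasSystem T 1 κ := by
  induction m with
  | zero => exact absurd h (not_hasSystem_zero hκ)
  | succ m ih => exact (hasSystem_succ hκ h).elim ih id

/-! ### Equality of the cardinal invariants -/

theorem hasShreddingChain_iff {T : L.Theory} {m : ℕ} (hm : 1 ≤ m) {κ : Cardinal.{max u v}}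
    (hκ : κ.IsRegular) : HasShreddingChain T m κ ↔ HasShreddingChain T 1 κ :=
  ⟨fun h => hasShreddingChain_of_hasSystem ((hasSystem_of_hasShreddingChain h).one hκ),
    fun h => hasShreddingChain_of_hasSystem ((hasSystem_of_hasShreddingChain h).of_one hm)⟩

theorem kappaShredIn_eq {T : L.Theory} {m : ℕ} (hm : 1 ≤ m) :
    kappaShredIn T m = kappaShredIn T 1 := by
  have h : ∀ κ : Cardinal.{max u v}, (κ.IsRegular ∧ ¬ HasShreddingChain T m κ) ↔
      (κ.IsRegular ∧ ¬ HasShreddingChain T 1 κ) := fun κ =>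
    and_congr_right fun hκ => not_congr (hasShreddingChain_iff hm hκ)
  unfold kappaShredIn
  simp only [h]
  split_ifs with h1 h2 h2
  · rfl
  · exact absurd ((exists_congr h).1 h1) h2
  · exact absurd ((exists_congr h).2 h2) h1
  · rfl

/-- The supremum defining `kappaShred` includes m = 0, where no regular cardinal is the length of a
chain; hence any regular cardinal admissible for m = 1 is admissible for m = 0. -/
theorem kappaShredIn_zero_le (T : L.Theory) : kappaShredIn T 0 ≤ kappaShredIn T 1 := by
  have h : ∀ κ : Cardinal.{max u v}, κ.IsRegular → ¬ HasShreddingChain T 0 κ := fun κ hκ h0 =>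
    not_hasSystem_zero hκ (hasSystem_of_hasShreddingChain h0)
  unfold kappaShredIn
  split_ifs with h0 h1 h1
  · refine WithTop.coe_le_coe.2 (csInf_le' ?_)
    exact ⟨(csInf_mem h1).1, h _ (csInf_mem h1).1⟩
  · exact le_top
  · obtain ⟨κ, hκ, -⟩ := h1
    exact absurd ⟨κ, hκ, h κ hκ⟩ h0
  · exact le_rfl

theorem kappaShred_eq (T : L.Theory) : kappaShred T = kappaShredIn T 1 := by
  refine le_antisymm (iSup_le fun m => ?_) (le_iSup (kappaShredIn T) 1)
  rcases Nat.eq_zero_or_pos m with rfl | hm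
  · exact kappaShredIn_zero_le T
  · exact (kappaShredIn_eq hm).le

end Shredding

theorem mainTheorem3 {L : FirstOrder.Language.{u, v}} (T : L.Theory) (hT : T.IsComplete) :
    (∀ m : ℕ, 1 ≤ m → Shredding.kappaShredIn T m = Shredding.kappaShredIn T 1) ∧
    Shredding.kappaShred T = Shredding.kappaShredIn T 1 ∧
    (Shredding.Unshreddable T ↔ Shredding.kappaShredIn T 1 < ⊤) := by
  refine ⟨fun m hm => Shredding.kappaShredIn_eq hm, Shredding.kappaShred_eq T, ?_⟩
  rw [Shredding.Unshreddable, Shredding.kappaShred_eq]
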